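/- Let $p_1,\dots,p_{n-1}$ be mutually distinct points of $\mathbb{C}$, let $p_n=\infty$, and put $M=(\mathbb{C}\cup\{\infty\})\setminus\{p_1,\dots,p_n\}$, with universal cover $\widetilde M$. Let $d\sigma^2$ be a (smooth) conformal metric of constant curvature $1$ on $M$ which has a conical singularity of some order $\beta_j>-1$ at each $p_j$ ($j=1,\dots,n$); that is, $d\sigma^2$ is asymptotic to $c_j|w-w(p_j)|^{2\beta_j}\,|dw|^2$ with $c_j\neq 0$, where $w=z$ if $j<n$ and $w=1/z$ if $j=n$. A developing map of $d\sigma^2$ is a holomorphic map $g\colon\widetilde M\to\mathbb{C}\cup\{\infty\}$ for which $d\sigma^2$ is the pull-back $4\,dg\,d\bar g/(1+g\bar g)^2$ of the Fubini–Study metric (it is unique up to Möbius transformations $g\mapsto a\star g$, $a\in\mathrm{SU}(2)$). The metric $d\sigma^2$ is called reducible if, for its developing map $g$, the image of the representation $\rho_g\colon\pi_1(M)\to\mathrm{SU}(2)$ with $g\circ T^{-1}=\rho_g(T)\star g$ ($T\in\pi_1(M)$) is commutative. Suppose that $d\sigma^2$ is reducible and that, for some $0\le m\leq n-1$, \[ \beta_1,\dots,\beta_m\notin\mathbb{Z},\qquad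 \beta_{m+1},\dots,\beta_{n-1}\in\mathbb{Z},\qquad \beta_n\notin\mathbb{Z}. \] Then, for every base point $z_0\in M$, there are $\tau_1,\dots,\tau_m\in\mathbb{R}\setminus\mathbb{Z}$ and a rational function $r$ on $\mathbb{C}\cup\{\infty\}$ such that $d\sigma^2$ has a developing map $g\colon\widetilde M\to\mathbb{C}\cup\{\infty\}$ given by \[ g=(z-p_1)^{\tau_1}\cdots(z-p_m)^{\tau_m}\,r(z),\qquad (z-p_1)^{\tau_1}\cdots(z-p_m)^{\tau_m}:=\exp\Bigl(\sum_{j=1}^m\tau_j\int_{z_0}^z\frac{d\zeta}{\zeta-p_j}\Bigr), \] where a point of $\widetilde M$ over $z\in M$ is a homotopy class of paths in $M$ from $z_0$ to $z$, and the integrals are taken along such a path. -/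

import Mathlib

open scoped Topology OnePoint

noncomputable section

namespace ConicalSpherical

/-! ### Metrics of constant curvature one on plane domains -/

/-- The Gaussian curvature of the conformal metric `lam(z) |dz|²`. -/
def gaussCurvature (lam : ℂ → ℝ) (z : ℂ) : ℝ :=
  -(Laplacian.laplacian (fun w => Real.log (lam w)) z) / (2 * lam z)

/-- `lam(z) |dz|²` is a (smooth, positive definite) conformal metric of constant curvature `1` on
the open set `U`. Only the values of `lam` on `U` matter. -/
structure IsSphericalMetricOn (lam : ℂ → ℝ) (U : Set ℂ) : Prop where
  smooth : ContDiffOn ℝ ((⊤ : ℕ∞) : WithTop ℕ∞) lam U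
  pos : ∀ z ∈ U, 0 < lam z
  curvature : ∀ z ∈ U, gaussCurvature lam z = 1

/-- The metric `lam(z) |dz|²` has a conical singularity of order `β > -1` at `a`:
it is asymptotic to `c |z - a|^(2β) |dz|²` with `c ≠ 0`. -/
def HasConicalSingularityAt (lam : ℂ → ℝ) (a : ℂ) (β : ℝ) : Prop :=
  -1 < β ∧ ∃ c : ℝ, c ≠ 0 ∧
    Filter.Tendsto (fun z : ℂ => lam z / ‖z - a‖ ^ (2 * β)) (𝓝[≠] a) (𝓝 c)

/-- The metric `lam(z) |dz|²` has a conical singularity of order `β` at `∞`. In the coordinate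
`w = 1 / z` around `∞` one has `lam(z) |dz|² = lam(1/w) |w|⁻⁴ |dw|²`. -/
def HasConicalSingularityAtInfty (lam : ℂ → ℝ) (β : ℝ) : Prop :=
  HasConicalSingularityAt (fun w : ℂ => lam w⁻¹ / ‖w‖ ^ 4) 0 β

/-! ### Universal covers and deck transformations -/

/-- The universal cover of `X` with base point `x₀`, realised as the set of homotopy classes
(with fixed end points) of paths in `X` starting at `x₀`. The covering projection is
`Sigma.fst`. -/
abbrev UniversalCover (X : Type*) [TopologicalSpace X] (x₀ : X) : Type _ :=
  Σ x : X, Path.Homotopic.Quotient x₀ x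

/-- The deck transformation of the universal cover given by a loop class `T`:
precomposition of paths with `T`. -/
def deck {X : Type*} [TopologicalSpace X] {x₀ : X} (T : FundamentalGroup X x₀)
    (x : UniversalCover X x₀) : UniversalCover X x₀ :=
  ⟨x.1, Path.Homotopic.Quotient.trans (FundamentalGroup.toPath T) x.2⟩

/-! ### The Riemann sphere, the Möbius action of `SU(2)`, and developing maps -/

/-- The special unitary group `SU(2)`. -/
abbrev SU2 : Type := Matrix.specialUnitaryGroup (Fin 2) ℂ

lemma SU2.det_ne_zero (a : SU2) : (a : Matrix (Fin 2) (Fin 2) ℂ).det ≠ 0 := by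
  have h := (Matrix.mem_specialUnitaryGroup_iff.1 a.2).2
  rw [h]
  exact one_ne_zero

/-- The Möbius transformation `q ↦ a ⋆ q = (a₁₁ q + a₁₂) / (a₂₁ q + a₂₂)` of the Riemann sphere
`ℂ ∪ {∞}` given by `a ∈ SU(2)`. -/
def SU2.moebius (a : SU2) (q : OnePoint ℂ) : OnePoint ℂ :=
  Matrix.GeneralLinearGroup.mkOfDetNeZero (a : Matrix (Fin 2) (Fin 2) ℂ) (SU2.det_ne_zero a) • q

open Classical in
/-- The inversion `q ↦ 1 / q` of the Riemann sphere, exchanging `0` and `∞`. -/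
def sphereInv : OnePoint ℂ → OnePoint ℂ
  | ∞ => ((0 : ℂ) : OnePoint ℂ)
  | (z : ℂ) => if z = 0 then ∞ else ((z⁻¹ : ℂ) : OnePoint ℂ)

/-- `F`, a map defined near the projection of `x`, represents `g` near the point `x` of the
universal cover of `U`: if the path class `x` is extended by a path `δ` that stays close to the
end point of `x`, then the value of `g` is the value of `F` at the end point of `δ`. -/
def IsLocalBranch {U : Set ℂ} {z₀ : U} (g : UniversalCover U z₀ → OnePoint ℂ)
    (x : UniversalCover U z₀) (F : ℂ → OnePoint ℂ) : Prop :=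
  ∃ ε : ℝ, 0 < ε ∧ ∀ (w : U) (δ : Path x.1 w), (∀ t, dist (δ t) x.1 < ε) →
    g ⟨w, Path.Homotopic.Quotient.trans x.2 (Path.Homotopic.Quotient.mk δ)⟩ = F w

/-- `g` is a developing map of the metric `lam(z) |dz|²` on `U`: a holomorphic map from the
universal cover of `U` to the Riemann sphere which pulls the Fubini-Study metric
`4 |dq|² / (1 + |q|²)²` back to `lam(z) |dz|²`. Near every point of the universal cover either `g`
or `1 / g` is given by a holomorphic function `h`; the Fubini-Study metric has the same
expression in the coordinates `q` and `1 / q` of the sphere. -/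
def IsDevelopingMap (lam : ℂ → ℝ) {U : Set ℂ} {z₀ : U}
    (g : UniversalCover U z₀ → OnePoint ℂ) : Prop :=
  ∀ x : UniversalCover U z₀, ∃ h : ℂ → ℂ, AnalyticAt ℂ h (x.1 : ℂ) ∧
    (IsLocalBranch g x (fun w => ((h w : ℂ) : OnePoint ℂ)) ∨
      IsLocalBranch g x (fun w => sphereInv ((h w : ℂ) : OnePoint ℂ))) ∧
    4 * ‖deriv h (x.1 : ℂ)‖ ^ 2 / (1 + ‖h (x.1 : ℂ)‖ ^ 2) ^ 2 = lam (x.1 : ℂ)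

/-- `ρ` is the monodromy representation of `g`: one has `g ∘ T⁻¹ = ρ(T) ⋆ g` for all deck
transformations `T`. -/
def IsMonodromyRep {U : Set ℂ} {z₀ : U} (g : UniversalCover U z₀ → OnePoint ℂ)
    (ρ : FundamentalGroup U z₀ →* SU2) : Prop :=
  ∀ (T : FundamentalGroup U z₀) (x : UniversalCover U z₀),
    g (deck T⁻¹ x) = SU2.moebius (ρ T) (g x)

/-- The metric `lam(z) |dz|²` on `U` is reducible: the image of the monodromy representation
`ρ` of its developing map `g` is a commutative subgroup of `SU(2)`. The developing map is unique
up to the action of `SU(2)`, which replaces `ρ` by a conjugate. -/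
def IsReducible (lam : ℂ → ℝ) (U : Set ℂ) (z₀ : U) : Prop :=
  ∃ (g : UniversalCover U z₀ → OnePoint ℂ) (ρ : FundamentalGroup U z₀ →* SU2),
    IsDevelopingMap lam g ∧ IsMonodromyRep g ρ ∧ ∀ a ∈ ρ.range, ∀ b ∈ ρ.range, a * b = b * a

/-! ### The data of the explicit form of the developing map -/

/-- The plane with the points `p j` removed, i.e. the Riemann sphere with the points `p j` and `∞`
removed. -/
def puncturedPlane {n : ℕ} (p : Fin n → ℂ) : Set ℂ := (Set.range p)ᶜ

/-- A path in `U`, seen as a path in `ℂ`. -/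
def pathInPlane {U : Set ℂ} {z₀ z : U} (γ : Path z₀ z) : Path (z₀ : ℂ) (z : ℂ) :=
  γ.map continuous_subtype_val

/-- The integral of `dz / (z - a)` along the path `γ`. -/
def logIntegral {U : Set ℂ} {z₀ z : U} (γ : Path z₀ z) (a : ℂ) : ℂ :=
  curveIntegral (fun w : ℂ => (w - a)⁻¹ • ContinuousLinearMap.id ℂ ℂ) (pathInPlane γ)

/-- The value `(∏ j, (z - p j) ^ τ j)`, `z` the end point of `γ`, of the multivalued power product
along the path `γ`, defined as `exp (∑ j, τ j * ∫_γ dz / (z - p j))`. -/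
def powerProduct {m : ℕ} (p : Fin m → ℂ) (τ : Fin m → ℝ) {U : Set ℂ} {z₀ z : U}
    (γ : Path z₀ z) : ℂ :=
  Complex.exp (∑ j, (τ j : ℂ) * logIntegral γ (p j))

open Classical in
/-- The value at `z`, in the Riemann sphere, of `c` times the rational function `r`, where `c` is a
nonzero complex number. -/
def mulRatFuncValue (c : ℂ) (r : RatFunc ℂ) (z : ℂ) : OnePoint ℂ :=
  if r.denom.eval z = 0 then ∞ else ((c * r.eval (RingHom.id ℂ) z : ℂ) : OnePoint ℂ)

end ConicalSpherical

end

/-!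
The developing map `g` of a reducible metric can be rotated so that its monodromy is diagonal
(`SU2.exists_conj_diagonal`: commuting elements of `SU(2)` have a common eigenvector), i.e. so that
all analytic continuations of `g` differ by unimodular factors (`HasRotationMonodromy`). Then
`q = g / g'` and `u = log |g|` are single valued on the punctured plane, and the identity
`4 |g'|² / (1 + |g|²)² = lam` turns into `lam |q|² cosh² u = 1`, with `du = Re (dz / q)`
(`exists_isReciprocalLogDeriv`). Working with `q` rather than `g' / g` pays off: `q` is holomorphic,
zeros and poles of `g` included, and `|q|² ≤ 1 / lam`, so that `q` has polynomial growth at the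
punctures and at infinity. Hence `q` is rational (`IsReciprocalLogDeriv.exists_polynomial`).

At a conical singularity of order `β` the rational function `f = 1 / q` has at most a simple pole:
near a higher pole, `u = Re ∫ f dz` would grow like a power of the inverse distance along a
suitable ray, and `lam = |f|² / cosh² u` would decay exponentially there. The residue `τ` is real
because `u` is single valued, and `u - τ log |z - p|` is bounded, so comparing the two sides of
`lam cosh² u = |f|²` gives `β = |τ| + k` with an integer `k` (`exists_real_residue`). The same lemma
applies at infinity in the coordinate `1 / z`. Therefore `g' / g = ∑ e_a / (z - a)`, where `e_a = ±1`
at the zeros and poles of `g`, and at a puncture `e_a` is an integer exactly when the order of the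
singularity is (`IsReciprocalLogDeriv.exists_partialFractions`).

The terms with non-integral residues integrate to the power product, all others to a rational
function `A / B`. To handle zeros and poles of `g` uniformly, branches of `g` are written as
`[h₁ : h₂]`; near every point of the universal cover `h₁ B = C P A h₂`, where `P` is a branch of the
power product and `C ≠ 0` a constant, because the Wronskian of the two sides vanishes
(`LogDerivData.exists_isMatched`). The constant is locally constant along paths
(`LogDerivData.isMatched_powerProduct`), so it depends on the base point only and is absorbed into
the rational function.
-/

noncomputable section

namespace ConicalSpherical

open Filter Bornology

/-! ### Removable singularities, polynomial growth and partial fractions -/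

/-- An entire function that is `o(z ^ N)` at infinity is a polynomial. The difference quotient at
`0` lowers the growth exponent by one; for `N = 0` this is Liouville's theorem. -/
theorem exists_polynomial_of_isLittleO_pow (N : ℕ) : ∀ Φ : ℂ → ℂ, Differentiable ℂ Φ →
    Φ =o[cobounded ℂ] (fun z => z ^ N) →
    ∃ P : Polynomial ℂ, ∀ z, Φ z = P.eval z := by
  induction N with
  | zero =>
    intro Φ hΦ ho
    refine ⟨0, fun z => ?_⟩
    have h0 : Tendsto Φ (cocompact ℂ) (𝓝 0) := by
      rw [← Metric.cobounded_eq_cocompact]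
      simpa using ho
    simpa using hΦ.apply_eq_of_tendsto_cocompact z h0
  | succ N ih =>
    intro Φ hΦ ho
    have hd : Differentiable ℂ (dslope Φ 0) := by
      have := (Complex.differentiableOn_dslope (f := Φ) (c := 0) univ_mem).2
        hΦ.differentiableOn
      exact differentiableOn_univ.1 this
    have hne : ∀ᶠ z : ℂ in cobounded ℂ, z ≠ 0 := by
      have := tendsto_norm_cobounded_atTop (E := ℂ)
      filter_upwards [this.eventually_gt_atTop 0] with z hz
      simpa using hz
    have hconst : (fun _ : ℂ => Φ 0) =o[cobounded ℂ] (fun z : ℂ => z ^ (N + 1)) := by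
      rw [Asymptotics.isLittleO_const_left]
      right
      have h1 : Tendsto (fun z : ℂ => ‖z‖ ^ (N + 1)) (cobounded ℂ) atTop :=
        (tendsto_pow_atTop (Nat.succ_ne_zero N)).comp tendsto_norm_cobounded_atTop
      refine h1.congr fun z => ?_
      simp
    obtain ⟨P, hP⟩ := ih _ hd (by
      have h2 := (ho.sub hconst).mul_isBigO
        (Asymptotics.isBigO_refl (fun z : ℂ => z⁻¹) (cobounded ℂ))
      refine h2.congr' ?_ ?_
      · filter_upwards [hne] with z hz
        rw [dslope_of_ne _ hz, slope_def_field]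
        simp [div_eq_mul_inv]
      · filter_upwards [hne] with z hz
        rw [pow_succ, mul_inv_cancel_right₀ hz])
    refine ⟨Polynomial.C (Φ 0) + Polynomial.X * P, fun z => ?_⟩
    have := sub_smul_dslope Φ 0 z
    rw [hP z] at this
    simp at this
    simp [this]

/-- A finite set of isolated singularities at which a function is `o(1 / |z - a|)` can be removed
simultaneously. -/
theorem exists_differentiable_eqOn_compl {S : Set ℂ} (hS : S.Finite) {F : ℂ → ℂ}
    (hF : ∀ z ∉ S, DifferentiableAt ℂ F z)
    (hsing : ∀ a ∈ S, Tendsto (fun z => (z - a) * F z) (𝓝[≠] a) (𝓝 0)) :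
    ∃ Φ : ℂ → ℂ, Differentiable ℂ Φ ∧ ∀ z ∉ S, Φ z = F z := by
  -- the punctured limit is a formula for the extension that needs no case distinction
  have key : ∀ z ∉ S, limUnder (𝓝[≠] z) F = F z := fun z hz =>
    ((hF z hz).continuousAt.tendsto.mono_left nhdsWithin_le_nhds).limUnder_eq
  refine ⟨fun z => limUnder (𝓝[≠] z) F, fun a => ?_, key⟩
  have hpunct : (S \ {a})ᶜ ∈ 𝓝 a :=
    (hS.subset Set.sdiff_subset).isClosed.isOpen_compl.mem_nhds (by simp)
  have hd : DifferentiableOn ℂ F ((S \ {a})ᶜ \ {a}) := by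
    intro z hz
    refine (hF z fun hzS => hz.1 ⟨hzS, hz.2⟩).differentiableWithinAt
  have ho : (fun z => F z - F a) =o[𝓝[≠] a] fun z => (z - a)⁻¹ := by
    have h0 : Tendsto (fun z => (z - a) * F z) (𝓝[≠] a) (𝓝 0) := by
      by_cases ha : a ∈ S
      · exact hsing a ha
      · have : Tendsto (fun z => (z - a) * F z) (𝓝 a) (𝓝 ((a - a) * F a)) :=
          ((continuous_id.sub continuous_const).tendsto a).mul (hF a ha).continuousAt.tendsto
        simpa using this.mono_left nhdsWithin_le_nhds
    have h1 : Tendsto (fun z => (z - a) * F a) (𝓝[≠] a) (𝓝 0) := by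
      have : Tendsto (fun z => (z - a) * F a) (𝓝 a) (𝓝 ((a - a) * F a)) :=
        ((continuous_id.sub continuous_const).tendsto a).mul tendsto_const_nhds
      simpa using this.mono_left nhdsWithin_le_nhds
    rw [Asymptotics.isLittleO_iff_tendsto']
    · have := h0.sub h1
      rw [sub_zero] at this
      refine this.congr fun z => ?_
      simp
      ring
    · filter_upwards [self_mem_nhdsWithin] with z hz h
      exact absurd h (inv_ne_zero (sub_ne_zero.2 hz))
  have := (Complex.differentiableOn_update_limUnder_of_isLittleO hpunct hd ho).differentiableAt
    hpunct
  refine this.congr_of_eventuallyEq ?_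
  filter_upwards [hpunct] with z hz
  by_cases hza : z = a
  · subst hza; simp
  · rw [Function.update_of_ne hza]
    exact key z fun hzS => hz ⟨hzS, hza⟩

/-- **Partial fractions** for a function with finitely many simple poles that is `O(1 / z)` at
infinity. -/
theorem eq_sum_div_of_simple_poles (S : Finset ℂ) {f : ℂ → ℂ} (c : ℂ → ℂ)
    (hf : ∀ z ∉ S, DifferentiableAt ℂ f z)
    (hpole : ∀ a ∈ S, Tendsto (fun z => (z - a) * f z) (𝓝[≠] a) (𝓝 (c a)))
    (hinf : Tendsto f (cobounded ℂ) (𝓝 0)) :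
    ∀ z ∉ S, f z = ∑ a ∈ S, c a / (z - a) := by
  set F : ℂ → ℂ := fun z => f z - ∑ a ∈ S, c a / (z - a) with hFdef
  obtain ⟨Φ, hΦ, hΦF⟩ := exists_differentiable_eqOn_compl (S := (S : Set ℂ)) S.finite_toSet
    (F := F) (by
      intro z hz
      refine (hf z hz).sub (DifferentiableAt.fun_sum fun a ha => ?_)
      refine (differentiableAt_const _).div (differentiableAt_id.sub_const a) ?_
      exact sub_ne_zero.2 fun h => hz (by simpa [← h] using ha))
    (by
      intro a ha
      have h1 : Tendsto (fun z => ∑ b ∈ S, (z - a) * (c b / (z - b))) (𝓝[≠] a)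
          (𝓝 (∑ b ∈ S, if b = a then c a else 0)) := by
        refine tendsto_finsetSum _ fun b hb => ?_
        split_ifs with hba
        · subst hba
          refine tendsto_const_nhds.congr' ?_
          filter_upwards [self_mem_nhdsWithin] with z hz
          rw [mul_div_cancel₀]
          exact sub_ne_zero.2 hz
        · have : Tendsto (fun z => (z - a) * (c b / (z - b))) (𝓝 a)
              (𝓝 ((a - a) * (c b / (a - b)))) := by
            refine ((continuous_id.sub continuous_const).tendsto a).mul (tendsto_const_nhds.div ((continuous_id.sub continuous_const).tendsto a) ?_)
            exact sub_ne_zero.2 (Ne.symm hba)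
          simpa using this.mono_left nhdsWithin_le_nhds
      have h2 := (hpole a (by simpa using ha)).sub h1
      have : (∑ b ∈ S, if b = a then c a else 0) = c a := by
        rw [Finset.sum_ite_eq' S a]
        simp only [Finset.mem_coe] at ha
        simp [ha]
      rw [this, sub_self] at h2
      refine h2.congr fun z => ?_
      rw [hFdef]
      simp only [mul_sub, Finset.mul_sum])
  have hS : ∀ᶠ z in cobounded ℂ, z ∉ S := by
    have : IsBounded (S : Set ℂ) := S.finite_toSet.isBounded
    filter_upwards [isBounded_def.1 this] with z hz using hz
  have hF0 : Tendsto Φ (cocompact ℂ) (𝓝 0) := by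
    rw [← Metric.cobounded_eq_cocompact]
    have hsum : Tendsto (fun z => ∑ a ∈ S, c a / (z - a)) (cobounded ℂ)
        (𝓝 (∑ a ∈ S, 0)) := by
      refine tendsto_finsetSum _ fun a _ => ?_
      have := (tendsto_inv₀_cobounded.comp (tendsto_sub_const_cobounded a)).const_mul (c a)
      simpa [div_eq_mul_inv] using this
    have := hinf.sub hsum
    simp only [Finset.sum_const_zero, sub_zero] at this
    refine this.congr' ?_
    filter_upwards [hS] with z hz
    rw [hΦF z (by simpa using hz)]
  intro z hz
  have := hΦ.apply_eq_of_tendsto_cocompact z hF0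
  rw [hΦF z (by simpa using hz)] at this
  exact sub_eq_zero.1 this

/-! ### Potentials of a holomorphic form near a puncture -/

/-- The real linear form `v ↦ Re (a v)`, the real part of the complex form `a dz`. -/
def reForm (a : ℂ) : ℂ →L[ℝ] ℝ := Complex.reCLM.comp (ContinuousLinearMap.mul ℝ ℂ a)

@[simp] theorem reForm_apply (a v : ℂ) : reForm a v = (a * v).re := rfl

theorem hasDerivAt_comp_of_reForm {u : ℂ → ℝ} {a : ℂ} {c : ℝ → ℂ} {c' : ℂ} {t : ℝ}
    (hu : HasFDerivAt u (reForm a) (c t)) (hc : HasDerivAt c c' t) :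
    HasDerivAt (fun s => u (c s)) (a * c').re t := by
  exact hu.comp_hasDerivAt t hc

theorem hasDerivAt_ray (p e : ℂ) (t : ℝ) : HasDerivAt (fun s : ℝ => p + s * e) e t := by
  simpa using ((Complex.ofRealCLM.hasDerivAt (x := t)).mul_const e).const_add p

theorem tendsto_ray (p e : ℂ) (he : ‖e‖ = 1) :
    Tendsto (fun s : ℝ => p + s * e) (𝓝[>] 0) (𝓝[≠] p) := by
  rw [tendsto_nhdsWithin_iff]
  constructor
  · have : Tendsto (fun s : ℝ => p + s * e) (𝓝 0) (𝓝 (p + (0 : ℝ) * e)) :=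
      (hasDerivAt_ray p e 0).continuousAt.tendsto
    simpa using this.mono_left nhdsWithin_le_nhds
  · filter_upwards [self_mem_nhdsWithin] with s hs
    have : e ≠ 0 := by intro h; simp [h] at he
    have hs' : (s : ℂ) ≠ 0 := by exact_mod_cast (ne_of_gt hs)
    simp [this, hs']

/-- A pole of order at least two of `f` makes `Re ∫ f dz` blow up like a power of the distance
along a suitable ray. -/
theorem exists_ray_lower_bound {p : ℂ} {f f₁ : ℂ → ℂ} {u : ℂ → ℝ} {k : ℤ}
    (hf₁ : ContinuousAt f₁ p) (hf₁p : f₁ p ≠ 0)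
    (hf : ∀ᶠ z in 𝓝[≠] p, f z = (z - p) ^ k * f₁ z)
    (hu : ∀ᶠ z in 𝓝[≠] p, HasFDerivAt u (reForm (f z)) z) (hk : k ≤ -2) :
    ∃ e : ℂ, ‖e‖ = 1 ∧ ∃ κ > 0, ∃ K : ℝ, ∀ᶠ t : ℝ in 𝓝[>] 0, κ * t⁻¹ + K ≤ u (p + t * e) := by
  set A : ℝ := ‖f₁ p‖ with hA
  have hApos : 0 < A := norm_pos_iff.2 hf₁p
  obtain ⟨n, hn⟩ : ∃ n : ℕ, k + 1 = -(n + 1 : ℕ) := ⟨(-(k + 2)).toNat, by omega⟩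
  -- in the direction `d⁻¹` the leading term of `f dz` is real and negative
  obtain ⟨d, hd⟩ := IsAlgClosed.exists_pow_nat_eq (-(A : ℂ) / f₁ p) (Nat.succ_pos n)
  have hd1 : ‖d‖ = 1 := by
    have h1 : ‖d‖ ^ (n + 1) = 1 := by
      rw [← norm_pow, hd, norm_div, norm_neg, Complex.norm_real, norm_norm, ← hA,
        div_self hApos.ne']
    exact (pow_eq_one_iff_of_nonneg (norm_nonneg _) (Nat.succ_ne_zero n)).1 h1
  have hd0 : d ≠ 0 := by intro h; simp [h] at hd1
  have he1 : ‖d⁻¹‖ = 1 := by rw [norm_inv, hd1, inv_one]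
  have hdir : d⁻¹ ^ (k + 1) * f₁ p = -(A : ℂ) := by
    rw [hn, zpow_neg, inv_zpow, inv_inv, zpow_natCast, hd, div_mul_cancel₀ _ hf₁p]
  refine ⟨d⁻¹, he1, A / 2, half_pos hApos, ?_⟩
  set e := d⁻¹
  have he0 : e ≠ 0 := inv_ne_zero hd0
  have hray := tendsto_ray p e he1
  have hre : Tendsto (fun t : ℝ => (e ^ (k + 1) * f₁ (p + t * e)).re) (𝓝[>] 0) (𝓝 (-A)) := by
    have h1 : Tendsto (fun t : ℝ => e ^ (k + 1) * f₁ (p + t * e)) (𝓝[>] 0) (𝓝 (-(A : ℂ))) := by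
      rw [← hdir]
      exact ((hf₁.tendsto.comp (hray.mono_right nhdsWithin_le_nhds))).const_mul _
    have h2 := (Complex.continuous_re.tendsto _).comp h1
    rwa [Complex.neg_re, Complex.ofReal_re] at h2
  have hev : ∀ᶠ t : ℝ in 𝓝[>] 0, HasDerivAt (fun s : ℝ => u (p + s * e))
      (f (p + t * e) * e).re t ∧ (f (p + t * e) * e).re ≤ -(A / 2) * (t ^ 2)⁻¹ := by
    have hlt : ∀ᶠ t : ℝ in 𝓝[>] 0, t < 1 :=
      (eventually_lt_nhds one_pos).filter_mono nhdsWithin_le_nhds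
    filter_upwards [hray.eventually hf, hray.eventually hu, hre.eventually_lt_const
      (show -A < -(A / 2) by linarith), self_mem_nhdsWithin, hlt] with t h1 h2 h3 ht h4
    have ht : 0 < t := ht
    refine ⟨hasDerivAt_comp_of_reForm h2 (hasDerivAt_ray p e t), ?_⟩
    have h5 : f (p + t * e) * e = ((t ^ k : ℝ) : ℂ) * (e ^ (k + 1) * f₁ (p + t * e)) := by
      rw [h1, add_sub_cancel_left, mul_zpow, zpow_add_one₀ he0]
      push_cast
      ring
    rw [h5, Complex.re_ofReal_mul]
    have h6 : (t ^ 2)⁻¹ ≤ t ^ k := by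
      have := zpow_le_zpow_right_of_le_one₀ ht h4.le hk
      simpa [zpow_neg] using this
    have h7 : 0 < t ^ k := zpow_pos ht _
    calc _ ≤ t ^ k * -(A / 2) := mul_le_mul_of_nonneg_left h3.le h7.le
      _ ≤ _ := by nlinarith
  obtain ⟨t₀, ht₀, hmem⟩ := mem_nhdsGT_iff_exists_Ioo_subset.1 hev
  have ht₀ : 0 < t₀ := ht₀
  have hanti : AntitoneOn (fun t : ℝ => u (p + t * e) - A / 2 * t⁻¹) (Set.Ioo 0 t₀) := by
    have hD : ∀ t ∈ Set.Ioo 0 t₀, HasDerivAt (fun t : ℝ => u (p + t * e) - A / 2 * t⁻¹)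
        ((f (p + t * e) * e).re - A / 2 * (-(t ^ 2)⁻¹)) t := fun t ht =>
      (hmem ht).1.sub ((hasDerivAt_inv ht.1.ne').const_mul _)
    refine antitoneOn_of_deriv_nonpos (convex_Ioo _ _)
      (fun t ht => (hD t ht).continuousAt.continuousWithinAt) ?_ ?_
    · intro t ht
      rw [interior_Ioo] at ht
      exact (hD t ht).differentiableAt.differentiableWithinAt
    · intro t ht
      rw [interior_Ioo] at ht
      rw [(hD t ht).deriv]
      have := (hmem ht).2
      linarith
  refine ⟨u (p + (t₀ / 2 : ℝ) * e) - A / 2 * (t₀ / 2)⁻¹, ?_⟩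
  filter_upwards [Ioo_mem_nhdsGT (half_pos ht₀)] with t ht
  have := hanti ⟨ht.1, by linarith [ht.2]⟩ ⟨half_pos ht₀, by linarith⟩ ht.2.le
  simp only at this
  linarith

/-- Reality of the residue: `Re ∫ f dz` is single valued. -/
theorem residue_im_eq_zero {p : ℂ} {f : ℂ → ℂ} {u : ℂ → ℝ} {c : ℂ}
    (hf : Tendsto (fun z => (z - p) * f z) (𝓝[≠] p) (𝓝 c))
    (hu : ∀ᶠ z in 𝓝[≠] p, HasFDerivAt u (reForm (f z)) z) : c.im = 0 := by
  by_contra hc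
  have hev : ∀ᶠ z in 𝓝[≠] p, ((z - p) * f z).im ≠ 0 ∧ HasFDerivAt u (reForm (f z)) z := by
    refine Filter.Eventually.and ?_ hu
    exact ((Complex.continuous_im.tendsto _).comp hf).eventually_ne hc
  rw [eventually_nhdsWithin_iff, Metric.eventually_nhds_iff] at hev
  obtain ⟨ε, hε, hball⟩ := hev
  set R : ℝ := ε / 2 with hR
  have hRpos : 0 < R := half_pos hε
  have hmem : ∀ θ : ℝ, ((circleMap p R θ - p) * f (circleMap p R θ)).im ≠ 0 ∧
      HasFDerivAt u (reForm (f (circleMap p R θ))) (circleMap p R θ) := by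
    intro θ
    refine hball ?_ (circleMap_ne_center hRpos.ne')
    rw [Metric.mem_sphere.1 (circleMap_mem_sphere p hRpos.le θ)]
    exact half_lt_self hε
  have hD : ∀ θ : ℝ, HasDerivAt (fun s => u (circleMap p R s))
      (f (circleMap p R θ) * (circleMap 0 R θ * Complex.I)).re θ := fun θ =>
    hasDerivAt_comp_of_reForm (hmem θ).2 (hasDerivAt_circleMap p R θ)
  -- Rolle: `u` takes the same value at both ends of a full turn
  obtain ⟨θ, -, hθ⟩ := exists_hasDerivAt_eq_zero (f := fun s => u (circleMap p R s))
    (f' := fun θ => (f (circleMap p R θ) * (circleMap 0 R θ * Complex.I)).re)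
    Real.two_pi_pos (fun θ _ => (hD θ).continuousAt.continuousWithinAt)
    (by simp [circleMap]) (fun θ _ => hD θ)
  refine (hmem θ).1 ?_
  have h1 : circleMap p R θ - p = circleMap 0 R θ := by simp [circleMap]
  rw [h1]
  have h2 : f (circleMap p R θ) * (circleMap 0 R θ * Complex.I)
      = circleMap 0 R θ * f (circleMap p R θ) * Complex.I := by ring
  simp only [h2, Complex.mul_I_re] at hθ
  linarith

/-- A potential of `f` differs from `τ log |z - p|` by a bounded function if `f - τ / (z - p)` is
bounded. -/
theorem isBoundedUnder_sub_log {p : ℂ} {f : ℂ → ℂ} {u : ℂ → ℝ} {τ : ℝ} {M : ℝ}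
    (hf : ∀ᶠ z in 𝓝[≠] p, ‖f z - τ / (z - p)‖ ≤ M)
    (hu : ∀ᶠ z in 𝓝[≠] p, HasFDerivAt u (reForm (f z)) z) :
    ∃ B : ℝ, ∀ᶠ z in 𝓝[≠] p, |u z - τ * Real.log ‖z - p‖| ≤ B := by
  have hev := hf.and hu
  rw [eventually_nhdsWithin_iff, Metric.eventually_nhds_iff] at hev
  obtain ⟨ε, hε, hball⟩ := hev
  set R : ℝ := ε / 2 with hR
  have hRpos : 0 < R := half_pos hε
  have hRε : R < ε := half_lt_self hε
  obtain ⟨B₀, hB₀⟩ : ∃ B₀, ∀ z ∈ Metric.sphere p R, ‖u z‖ ≤ B₀ := by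
    refine (isCompact_sphere p R).exists_bound_of_continuousOn fun z hz => ?_
    refine (hball ?_ ?_).2.continuousAt.continuousWithinAt
    · rw [Metric.mem_sphere.1 hz]; exact hRε
    · exact Metric.ne_of_mem_sphere hz hRpos.ne'
  refine ⟨M * R + (B₀ + |τ * Real.log R|), ?_⟩
  rw [eventually_nhdsWithin_iff, Metric.eventually_nhds_iff]
  refine ⟨R, hRpos, fun z hz hzp => ?_⟩
  have hzp : z - p ≠ 0 := sub_ne_zero.2 hzp
  set t : ℝ := ‖z - p‖ with ht
  have htpos : 0 < t := norm_pos_iff.2 hzp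
  have htR : t < R := by rwa [ht, ← dist_eq_norm]
  set e : ℂ := (z - p) / t with he
  have htc : (t : ℂ) ≠ 0 := by exact_mod_cast htpos.ne'
  have he1 : ‖e‖ = 1 := by
    rw [he, norm_div, Complex.norm_real, norm_norm, div_self htpos.ne']
  have he0 : e ≠ 0 := by intro h; simp [h] at he1
  have hz_eq : p + t * e = z := by rw [he, mul_div_cancel₀ _ htc]; ring
  have hdist : ∀ s : ℝ, 0 < s → ‖p + s * e - p‖ = s := by
    intro s hs
    rw [add_sub_cancel_left, norm_mul, he1, mul_one, Complex.norm_real, Real.norm_of_nonneg hs.le]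
  have hD : ∀ s ∈ Set.Icc t R, HasDerivWithinAt
      (fun s : ℝ => u (p + s * e) - τ * Real.log s)
      ((f (p + s * e) - τ / (p + s * e - p)) * e).re (Set.Icc t R) s := by
    intro s hs
    have hspos : 0 < s := htpos.trans_le hs.1
    have hsc : (s : ℂ) ≠ 0 := by exact_mod_cast hspos.ne'
    have hb := hball (y := p + s * e) (by
      rw [dist_eq_norm, hdist s hspos]; exact hs.2.trans_lt hRε) (by simp [hsc, he0])
    have h1 := (hasDerivAt_comp_of_reForm (c := fun s : ℝ => p + s * e) hb.2 (hasDerivAt_ray p e s)).sub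
      ((Real.hasDerivAt_log hspos.ne').const_mul τ)
    have h2 : ((f (p + s * e) - τ / (p + s * e - p)) * e).re
        = (f (p + s * e) * e).re - τ * s⁻¹ := by
      have : (f (p + s * e) - τ / (p + s * e - p)) * e
          = f (p + s * e) * e - ((τ * s⁻¹ : ℝ) : ℂ) := by
        rw [add_sub_cancel_left]
        push_cast
        field_simp
      rw [this, Complex.sub_re, Complex.ofReal_re]
    rw [h2]
    exact h1.hasDerivWithinAt
  have hbound : ∀ s ∈ Set.Icc t R,
      ‖((f (p + s * e) - τ / (p + s * e - p)) * e).re‖ ≤ M := by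
    intro s hs
    have hspos : 0 < s := htpos.trans_le hs.1
    have hsc : (s : ℂ) ≠ 0 := by exact_mod_cast hspos.ne'
    have hb := hball (y := p + s * e) (by
      rw [dist_eq_norm, hdist s hspos]; exact hs.2.trans_lt hRε) (by simp [hsc, he0])
    refine (Complex.abs_re_le_norm _).trans ?_
    rw [norm_mul, he1, mul_one]
    exact hb.1
  have hM : 0 ≤ M := (norm_nonneg _).trans (hbound t ⟨le_rfl, htR.le⟩)
  -- integrate along the ray from `z` to the circle of radius `R`, where `u` is bounded
  have hmvt := (convex_Icc t R).norm_image_sub_le_of_norm_hasDerivWithin_le hD hbound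
    (Set.right_mem_Icc.2 htR.le) (Set.left_mem_Icc.2 htR.le)
  simp only [hz_eq] at hmvt
  have h3 : ‖u (p + R * e)‖ ≤ B₀ := hB₀ _ (by
    rw [Metric.mem_sphere, dist_eq_norm, hdist R hRpos])
  have h4 : ‖t - R‖ ≤ R := by
    rw [Real.norm_eq_abs, abs_le]; constructor <;> linarith
  have h5 : M * ‖t - R‖ ≤ M * R := mul_le_mul_of_nonneg_left h4 hM
  rw [Real.norm_eq_abs] at hmvt h3
  have h6 := abs_sub_abs_le_abs_sub (u z - τ * Real.log t) (u (p + R * e) - τ * Real.log R)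
  have h7 := abs_sub (u (p + R * e)) (τ * Real.log R)
  linarith

/-! ### The logarithmic derivative at a conical singularity -/

theorem eq_zero_of_rpow_mem_Icc {s C₁ C₂ : ℝ} (hC₁ : 0 < C₁)
    (h : ∀ᶠ r : ℝ in 𝓝[>] 0, C₁ ≤ r ^ s ∧ r ^ s ≤ C₂) : s = 0 := by
  rcases lt_trichotomy s 0 with hs | hs | hs
  · have h1 : Tendsto (fun r : ℝ => r ^ s) (𝓝[>] 0) atTop := by
      have := (tendsto_rpow_atTop (neg_pos.2 hs)).comp tendsto_inv_nhdsGT_zero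
      refine this.congr' ?_
      filter_upwards [self_mem_nhdsWithin] with r hr
      have hr : 0 < r := hr
      simp [Real.inv_rpow hr.le, Real.rpow_neg hr.le]
    obtain ⟨r, h2, h3⟩ := ((h1.eventually_gt_atTop C₂).and h).exists
    linarith [h3.2]
  · exact hs
  · have h1 : Tendsto (fun r : ℝ => r ^ s) (𝓝[>] 0) (𝓝 0) := by
      have := (Real.continuousAt_rpow_const 0 s (Or.inr hs.le)).tendsto
      rw [Real.zero_rpow hs.ne'] at this
      exact this.mono_left nhdsWithin_le_nhds
    obtain ⟨r, h2, h3⟩ := ((h1.eventually_lt_const hC₁).and h).exists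
    linarith [h3.1]

theorem cosh_le_exp_abs (x : ℝ) : Real.cosh x ≤ Real.exp |x| := by
  rw [Real.cosh_eq]
  have h1 := Real.exp_le_exp.2 (le_abs_self x)
  have h2 := Real.exp_le_exp.2 (neg_le_abs x)
  linarith

theorem exp_abs_le_two_mul_cosh (x : ℝ) : Real.exp |x| ≤ 2 * Real.cosh x := by
  rw [← Real.cosh_abs, Real.cosh_eq]
  have := Real.exp_pos (-|x|)
  linarith

section Puncture

variable {p : ℂ} {f : ℂ → ℂ} {u lam : ℂ → ℝ} {β : ℝ}

theorem HasConicalSingularityAt.exists_bounds (hcone : HasConicalSingularityAt lam p β)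
    (hpos : ∀ᶠ z in 𝓝[≠] p, 0 ≤ lam z) :
    ∃ c > 0, ∀ᶠ z in 𝓝[≠] p, c / 2 * ‖z - p‖ ^ (2 * β) ≤ lam z ∧
      lam z ≤ 2 * c * ‖z - p‖ ^ (2 * β) := by
  obtain ⟨-, c, hc0, hc⟩ := hcone
  have hc_nonneg : 0 ≤ c := ge_of_tendsto hc (by
    filter_upwards [hpos] with z hz
    exact div_nonneg hz (Real.rpow_nonneg (norm_nonneg _) _))
  have hcpos : 0 < c := lt_of_le_of_ne hc_nonneg (Ne.symm hc0)
  refine ⟨c, hcpos, ?_⟩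
  filter_upwards [hc.eventually_const_lt (half_lt_self hcpos),
    hc.eventually_lt_const (show c < 2 * c by linarith), self_mem_nhdsWithin] with z h1 h2 hz
  have hr : 0 < ‖z - p‖ ^ (2 * β) := Real.rpow_pos_of_pos (norm_pos_iff.2 (sub_ne_zero.2 hz)) _
  rw [lt_div_iff₀ hr] at h1
  rw [div_lt_iff₀ hr] at h2
  exact ⟨h1.le, h2.le⟩

/-- At a conical singularity the logarithmic derivative of the developing map has at most a simple
pole, since a higher pole would make the metric decay exponentially along a ray. -/
theorem neg_one_le_order {f₁ : ℂ → ℂ} {k : ℤ}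
    (hf₁ : ContinuousAt f₁ p) (hf₁p : f₁ p ≠ 0)
    (hf : ∀ᶠ z in 𝓝[≠] p, f z = (z - p) ^ k * f₁ z)
    (hu : ∀ᶠ z in 𝓝[≠] p, HasFDerivAt u (reForm (f z)) z)
    (hrel : ∀ᶠ z in 𝓝[≠] p, lam z * Real.cosh (u z) ^ 2 = ‖f z‖ ^ 2)
    {c : ℝ} (hc : 0 < c) (hlam : ∀ᶠ z in 𝓝[≠] p, c * ‖z - p‖ ^ (2 * β) ≤ lam z) :
    -1 ≤ k := by
  by_contra hk
  obtain ⟨e, he, κ, hκ, K, hK⟩ := exists_ray_lower_bound hf₁ hf₁p hf hu (by omega)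
  have hray := tendsto_ray p e he
  have hbig := (tendsto_exp_mul_div_rpow_atTop (2 * β - 2 * k) (2 * κ) (by positivity)).comp
    (tendsto_inv_nhdsGT_zero (𝕜 := ℝ))
  set A := ‖f₁ p‖ + 1
  have hA : ∀ᶠ z in 𝓝[≠] p, ‖f₁ z‖ ≤ A := by
    have := hf₁.norm.eventually_lt continuousAt_const (show ‖f₁ p‖ < A by simp [A])
    exact (this.filter_mono nhdsWithin_le_nhds).mono fun z hz => hz.le
  obtain ⟨t, h1, h2, h3, h4, h5, h6, ht⟩ := ((hbig.eventually_gt_atTop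
    (4 * A ^ 2 / (c * Real.exp (2 * K)))).and (hK.and ((hray.eventually hf).and
    ((hray.eventually hrel).and ((hray.eventually hlam).and ((hray.eventually hA).and
      self_mem_nhdsWithin)))))).exists
  have ht : 0 < t := ht
  have hnorm : ‖p + t * e - p‖ = t := by
    rw [add_sub_cancel_left, norm_mul, he, mul_one, Complex.norm_real, Real.norm_of_nonneg ht.le]
  set z := p + t * e
  rw [hnorm] at h5
  have hfz : ‖f z‖ ^ 2 = t ^ (2 * k : ℝ) * ‖f₁ z‖ ^ 2 := by
    rw [h3, norm_mul, norm_zpow, hnorm, mul_pow, ← zpow_natCast, ← zpow_mul, ← Real.rpow_intCast]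
    congr 2
    push_cast
    ring
  have hcosh : Real.exp (2 * (κ * t⁻¹ + K)) / 4 ≤ Real.cosh (u z) ^ 2 := by
    have h7 : Real.exp (κ * t⁻¹ + K) ≤ 2 * Real.cosh (u z) :=
      (Real.exp_le_exp.2 (h2.trans (le_abs_self _))).trans (exp_abs_le_two_mul_cosh _)
    have h8 : Real.exp (2 * (κ * t⁻¹ + K)) = Real.exp (κ * t⁻¹ + K) ^ 2 := by
      rw [sq, ← Real.exp_add]; ring_nf
    have h9 := pow_le_pow_left₀ (Real.exp_pos _).le h7 2
    rw [h8]
    linarith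
  have hmain : c * t ^ (2 * β) * (Real.exp (2 * (κ * t⁻¹ + K)) / 4)
      ≤ t ^ (2 * k : ℝ) * A ^ 2 := by
    calc _ ≤ lam z * Real.cosh (u z) ^ 2 := by
            have : 0 ≤ c * t ^ (2 * β) := by positivity
            exact mul_le_mul h5 hcosh (by positivity) (this.trans h5)
      _ = t ^ (2 * k : ℝ) * ‖f₁ z‖ ^ 2 := by rw [h4, hfz]
      _ ≤ _ := by gcongr
  simp only [Function.comp_apply] at h1
  rw [Real.inv_rpow ht.le, Real.rpow_sub ht, div_lt_div_iff₀ (by positivity) (by positivity)] at h1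
  have h10 : Real.exp (2 * (κ * t⁻¹ + K)) = Real.exp (2 * κ * t⁻¹) * Real.exp (2 * K) := by
    rw [← Real.exp_add]; ring_nf
  rw [h10] at hmain
  have hk0 : 0 < t ^ (2 * k : ℝ) := by positivity
  have hb0 : 0 < t ^ (2 * β) := by positivity
  have h11 : 4 * A ^ 2 * (t ^ (2 * β) / t ^ (2 * k : ℝ))⁻¹
      = 4 * (t ^ (2 * k : ℝ) * A ^ 2) / t ^ (2 * β) := by
    field_simp
  rw [h11, div_lt_iff₀ hb0] at h1
  linarith

/-- At a conical singularity of order `β` of the metric `‖f‖² / cosh² u · |dz|²`, `u = Re ∫ f dz`,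
the meromorphic function `f` has at most a simple pole, its residue `τ` is real, and
`β = |τ| + k` for an integer `k`. -/
theorem exists_real_residue (hf : MeromorphicAt f p)
    (hu : ∀ᶠ z in 𝓝[≠] p, HasFDerivAt u (reForm (f z)) z)
    (hrel : ∀ᶠ z in 𝓝[≠] p, lam z * Real.cosh (u z) ^ 2 = ‖f z‖ ^ 2)
    (hcone : HasConicalSingularityAt lam p β) :
    ∃ (τ : ℝ) (k : ℤ), β = |τ| + k ∧ Tendsto (fun z => (z - p) * f z) (𝓝[≠] p) (𝓝 τ) := by
  have hlam_nonneg : ∀ᶠ z in 𝓝[≠] p, 0 ≤ lam z := by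
    filter_upwards [hrel] with z hz
    refine nonneg_of_mul_nonneg_left (b := Real.cosh (u z) ^ 2) ?_ (by positivity)
    rw [hz]
    positivity
  obtain ⟨c, hc, hbd⟩ := hcone.exists_bounds hlam_nonneg
  have hne : ∀ᶠ z in 𝓝[≠] p, f z ≠ 0 := by
    filter_upwards [hbd, hrel, self_mem_nhdsWithin] with z h1 h2 hz h0
    have hr : 0 < ‖z - p‖ ^ (2 * β) := Real.rpow_pos_of_pos (norm_pos_iff.2 (sub_ne_zero.2 hz)) _
    have hl : 0 < lam z := lt_of_lt_of_le (by positivity) h1.1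
    rw [h0] at h2
    have : 0 < lam z * Real.cosh (u z) ^ 2 := by positivity
    simp at h2
    rcases h2 with h2 | h2
    · exact hl.ne' h2
    · exact (Real.cosh_pos _).ne' h2
  obtain ⟨k, hk⟩ := WithTop.ne_top_iff_exists.1
    ((meromorphicOrderAt_ne_top_iff_eventually_ne_zero hf).2 hne)
  obtain ⟨f₁, hf₁, hf₁p, hff₁⟩ := (meromorphicOrderAt_eq_int_iff hf).1 hk.symm
  simp only [smul_eq_mul] at hff₁
  have hk1 : -1 ≤ k := neg_one_le_order hf₁.continuousAt hf₁p hff₁ hu hrel (half_pos hc)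
    (hbd.mono fun z hz => hz.1)
  have hf₁t : Tendsto f₁ (𝓝[≠] p) (𝓝 (f₁ p)) :=
    hf₁.continuousAt.tendsto.mono_left nhdsWithin_le_nhds
  have hsub : Tendsto (fun z => z - p) (𝓝[≠] p) (𝓝 0) := by
    have : Tendsto (fun z => z - p) (𝓝 p) (𝓝 (p - p)) :=
      (continuous_id.sub continuous_const).tendsto p
    simpa using this.mono_left nhdsWithin_le_nhds
  -- the residue `τ`, the limit of `(z - p) f`, and boundedness of the regular part
  obtain ⟨τ, hτ, M, hM⟩ : ∃ τ : ℝ, Tendsto (fun z => (z - p) * f z) (𝓝[≠] p) (𝓝 τ) ∧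
      ∃ M : ℝ, (∀ᶠ z in 𝓝[≠] p, ‖f z - τ / (z - p)‖ ≤ M) := by
    rcases eq_or_lt_of_le hk1 with hk' | hk'
    · have h1 : Tendsto (fun z => (z - p) * f z) (𝓝[≠] p) (𝓝 (f₁ p)) := by
        refine hf₁t.congr' ?_
        filter_upwards [hff₁, self_mem_nhdsWithin] with z hz hzp
        rw [hz, ← hk', zpow_neg_one, mul_inv_cancel_left₀ (sub_ne_zero.2 hzp)]
      have h2 : ((f₁ p).re : ℂ) = f₁ p := by
        apply Complex.ext
        · simp
        · simp [residue_im_eq_zero h1 hu]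
      refine ⟨(f₁ p).re, by rwa [h2], ‖deriv f₁ p‖ + 1, ?_⟩
      have h3 := (hf₁.differentiableAt.hasDerivAt.tendsto_slope).norm.eventually_lt_const
        (lt_add_one ‖deriv f₁ p‖)
      filter_upwards [h3, hff₁, self_mem_nhdsWithin] with z hz hz2 hzp
      have hzp' := sub_ne_zero.2 hzp
      have : f z - ((f₁ p).re : ℂ) / (z - p) = slope f₁ p z := by
        rw [h2, hz2, ← hk', slope_def_field, zpow_neg_one]
        field_simp
      rw [this]
      exact hz.le
    · obtain ⟨n, rfl⟩ := Int.eq_ofNat_of_zero_le (show 0 ≤ k by omega)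
      have h0 : Tendsto f (𝓝[≠] p) (𝓝 (0 ^ n * f₁ p)) := by
        refine ((hsub.pow n).mul hf₁t).congr' ?_
        filter_upwards [hff₁] with z hz
        rw [hz, zpow_natCast]
      refine ⟨0, ?_, ‖0 ^ n * f₁ p‖ + 1, ?_⟩
      · simpa using hsub.mul h0
      · filter_upwards [h0.norm.eventually_lt_const (lt_add_one _)] with z hz
        simpa using hz.le
  obtain ⟨B, hB⟩ := isBoundedUnder_sub_log hM hu
  refine ⟨τ, k, ?_, hτ⟩
  have hray := tendsto_ray p 1 (by simp)
  have hA : ∀ᶠ z in 𝓝[≠] p, ‖f₁ p‖ / 2 ≤ ‖f₁ z‖ ∧ ‖f₁ z‖ ≤ 2 * ‖f₁ p‖ := by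
    have h0 := norm_pos_iff.2 hf₁p
    filter_upwards [hf₁t.norm.eventually_const_lt (half_lt_self h0),
      hf₁t.norm.eventually_lt_const (show ‖f₁ p‖ < 2 * ‖f₁ p‖ by linarith)] with z h1 h2
    exact ⟨h1.le, h2.le⟩
  have hB2 : 0 < Real.exp (-(2 * B)) := Real.exp_pos _
  set a := ‖f₁ p‖ with ha
  have ha0 : 0 < a := norm_pos_iff.2 hf₁p
  -- along a ray both sides of the relation are comparable to powers of the distance `r` to `p`
  have hs : 2 * k + 2 * |τ| - 2 * β = 0 := by
    refine eq_zero_of_rpow_mem_Icc (C₁ := c * Real.exp (-(2 * B)) / (32 * a ^ 2))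
      (C₂ := 8 * c * Real.exp (2 * B) / a ^ 2) (by positivity) ?_
    have hlt : ∀ᶠ t : ℝ in 𝓝[>] 0, t < 1 :=
      (eventually_lt_nhds one_pos).filter_mono nhdsWithin_le_nhds
    filter_upwards [hray.eventually hff₁, hray.eventually hrel, hray.eventually hbd,
      hray.eventually hB, hray.eventually hA, hlt, self_mem_nhdsWithin] with r h1 h2 h3 h4 h5 h6 hr
    have hr : 0 < r := hr
    have hnorm : ‖p + r * 1 - p‖ = r := by
      rw [add_sub_cancel_left, mul_one, Complex.norm_real, Real.norm_of_nonneg hr.le]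
    set z := p + r * 1
    rw [hnorm] at h3 h4
    set l := Real.log r with hl
    have hl0 : l < 0 := Real.log_neg hr h6
    have hτl : |τ * l| = |τ| * -l := by rw [abs_mul, abs_of_neg hl0]
    have hub : |u z| ≤ -(|τ| * l) + B := by
      have := abs_sub_abs_le_abs_sub (u z) (τ * l)
      linarith
    have hlb : -(|τ| * l) - B ≤ |u z| := by
      have := abs_sub_abs_le_abs_sub (τ * l) (u z)
      rw [abs_sub_comm] at this
      linarith
    have hcu : Real.cosh (u z) ≤ Real.exp (-(|τ| * l) + B) :=
      (cosh_le_exp_abs _).trans (Real.exp_le_exp.2 hub)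
    have hcl : Real.exp (-(|τ| * l) - B) ≤ 2 * Real.cosh (u z) :=
      (Real.exp_le_exp.2 hlb).trans (exp_abs_le_two_mul_cosh _)
    have hfz : ‖f z‖ ^ 2 = Real.exp (l * (2 * k)) * ‖f₁ z‖ ^ 2 := by
      rw [h1, norm_mul, norm_zpow, hnorm, mul_pow, ← zpow_natCast, ← zpow_mul, ← Real.rpow_intCast,
        Real.rpow_def_of_pos hr]
      congr 3
      push_cast
      ring
    rw [Real.rpow_def_of_pos hr, ← hl] at h3
    rw [Real.rpow_def_of_pos hr, ← hl]
    have hcosh0 := Real.cosh_pos (u z)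
    have hsq : ∀ x, Real.exp x ^ 2 = Real.exp (2 * x) := fun x => by
      rw [sq, ← Real.exp_add]; ring_nf
    rw [hfz] at h2
    have hE := Real.exp_pos (l * (2 * β - 2 * |τ|))
    have hsplit : Real.exp (l * (2 * k)) =
        Real.exp (l * (2 * k + 2 * |τ| - 2 * β)) * Real.exp (l * (2 * β - 2 * |τ|)) := by
      rw [← Real.exp_add]; ring_nf
    rw [hsplit] at h2
    set X := Real.exp (l * (2 * k + 2 * |τ| - 2 * β))
    set E := Real.exp (l * (2 * β - 2 * |τ|))
    have hX : 0 < X := Real.exp_pos _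
    constructor
    · rw [div_le_iff₀ (by positivity)]
      have h7 := pow_le_pow_left₀ (Real.exp_pos _).le hcl 2
      rw [hsq] at h7
      have h8 : Real.exp (l * (2 * β)) * Real.exp (2 * (-(|τ| * l) - B))
          = E * Real.exp (-(2 * B)) := by
        rw [← Real.exp_add, ← Real.exp_add]; ring_nf
      have h9 : c / 2 * (E * Real.exp (-(2 * B))) ≤ 4 * (X * E * ‖f₁ z‖ ^ 2) := by
        rw [← h2, ← h8]
        have := mul_le_mul h3.1 h7 (Real.exp_pos _).le (le_trans (by positivity) h3.1)
        linarith
      have h10 : ‖f₁ z‖ ^ 2 ≤ (2 * a) ^ 2 := pow_le_pow_left₀ (norm_nonneg _) h5.2 2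
      have h11 : c / 2 * (E * Real.exp (-(2 * B))) ≤ 4 * (X * E * (2 * a) ^ 2) :=
        h9.trans (by gcongr)
      refine le_of_mul_le_mul_right ?_ hE
      linarith
    · rw [le_div_iff₀ (by positivity)]
      have h7 := pow_le_pow_left₀ hcosh0.le hcu 2
      rw [hsq] at h7
      have h8 : Real.exp (l * (2 * β)) * Real.exp (2 * (-(|τ| * l) + B))
          = E * Real.exp (2 * B) := by
        rw [← Real.exp_add, ← Real.exp_add]; ring_nf
      have h9 : X * E * ‖f₁ z‖ ^ 2 ≤ 2 * c * (E * Real.exp (2 * B)) := by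
        rw [← h2, ← h8]
        have := mul_le_mul h3.2 h7 (by positivity) (by positivity)
        linarith
      have h10 : (a / 2) ^ 2 ≤ ‖f₁ z‖ ^ 2 := pow_le_pow_left₀ (by positivity) h5.1 2
      have h11 : X * E * (a / 2) ^ 2 ≤ 2 * c * (E * Real.exp (2 * B)) :=
        le_trans (by gcongr) h9
      refine le_of_mul_le_mul_right ?_ hE
      linarith
  linarith

end Puncture

/-! ### The logarithmic derivative on the punctured plane -/

/-- `q` is the reciprocal `g / g'` of the logarithmic derivative and `u` the logarithm `log |g|`
of a multivalued function `g` on `U` whose monodromy consists of rotations `g ↦ χ g`, `|χ| = 1`,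
and which pulls the Fubini-Study metric back to `lam(z) |dz|²`. -/
structure IsReciprocalLogDeriv (U : Set ℂ) (lam : ℂ → ℝ) (q : ℂ → ℂ) (u : ℂ → ℝ) : Prop where
  analyticAt : ∀ z ∈ U, AnalyticAt ℂ q z
  deriv_of_eq_zero : ∀ z ∈ U, q z = 0 → deriv q z = 1 ∨ deriv q z = -1
  hasFDerivAt : ∀ z ∈ U, q z ≠ 0 → HasFDerivAt u (reForm (q z)⁻¹) z
  metric : ∀ z ∈ U, q z ≠ 0 → lam z * Real.cosh (u z) ^ 2 = ‖(q z)⁻¹‖ ^ 2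

theorem isOpen_puncturedPlane {n : ℕ} (p : Fin n → ℂ) : IsOpen (puncturedPlane p) :=
  (Set.finite_range p).isClosed.isOpen_compl

theorem eventually_mem_puncturedPlane {n : ℕ} (p : Fin n → ℂ) (a : ℂ) :
    ∀ᶠ z in 𝓝[≠] a, z ∈ puncturedPlane p := by
  have h : (Set.range p \ {a})ᶜ ∈ 𝓝 a :=
    ((Set.finite_range p).subset Set.sdiff_subset).isClosed.isOpen_compl.mem_nhds (by simp)
  filter_upwards [mem_nhdsWithin_of_mem_nhds h, self_mem_nhdsWithin] with z hz hza hzp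
  exact hz ⟨hzp, hza⟩

theorem eventually_cobounded_mem_puncturedPlane {n : ℕ} (p : Fin n → ℂ) :
    ∀ᶠ z in cobounded ℂ, z ∈ puncturedPlane p :=
  isBounded_def.1 (Set.finite_range p).isBounded

/-- A function with `lam |q|² ≤ 1` grows at most like a power at a conical singularity of `lam`. -/
theorem HasConicalSingularityAt.isBigO_one {p : ℂ} {lam : ℂ → ℝ} {β : ℝ} {q : ℂ → ℂ}
    (hcone : HasConicalSingularityAt lam p β) (hpos : ∀ᶠ z in 𝓝[≠] p, 0 ≤ lam z)
    (hq : ∀ᶠ z in 𝓝[≠] p, lam z * ‖q z‖ ^ 2 ≤ 1) {N : ℕ} (hN : β ≤ N) :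
    (fun z => (z - p) ^ N * q z) =O[𝓝[≠] p] (fun _ => (1 : ℝ)) := by
  obtain ⟨c, hc, hbd⟩ := hcone.exists_bounds hpos
  have hr1 : ∀ᶠ z in 𝓝[≠] p, ‖z - p‖ < 1 := by
    have : ∀ᶠ z in 𝓝 p, dist z p < 1 := Metric.ball_mem_nhds p one_pos
    filter_upwards [mem_nhdsWithin_of_mem_nhds this] with z hz
    rwa [← dist_eq_norm]
  refine Asymptotics.IsBigO.of_bound (Real.sqrt (2 / c)) ?_
  filter_upwards [hbd, hq, hr1, self_mem_nhdsWithin] with z h1 h2 h3 hz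
  have hr : 0 < ‖z - p‖ := norm_pos_iff.2 (sub_ne_zero.2 hz)
  rw [norm_one, mul_one]
  refine Real.le_sqrt_of_sq_le ?_
  rw [norm_mul, norm_pow, mul_pow, le_div_iff₀ hc]
  have h4 : (‖z - p‖ ^ N) ^ 2 ≤ ‖z - p‖ ^ (2 * β) := by
    rw [← pow_mul, ← Real.rpow_natCast]
    refine Real.rpow_le_rpow_of_exponent_ge hr h3.le ?_
    push_cast
    linarith
  have h5 : c / 2 * ‖z - p‖ ^ (2 * β) * ‖q z‖ ^ 2 ≤ 1 :=
    (mul_le_mul_of_nonneg_right h1.1 (by positivity)).trans h2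
  have h6 := mul_le_mul_of_nonneg_right h4 (show 0 ≤ ‖q z‖ ^ 2 * c by positivity)
  linarith

theorem mem_range_intCast_iff_of_eq_abs_add {β τ : ℝ} {k : ℤ} (h : β = |τ| + k) :
    τ ∈ Set.range ((↑) : ℤ → ℝ) ↔ β ∈ Set.range ((↑) : ℤ → ℝ) := by
  constructor
  · rintro ⟨a, rfl⟩
    exact ⟨|a| + k, by push_cast [h]; rfl⟩
  · rintro ⟨b, rfl⟩
    have h1 : |τ| = ((b - k : ℤ) : ℝ) := by push_cast; linarith
    rcases abs_choice τ with h2 | h2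
    · exact ⟨b - k, by rw [← h1, h2]⟩
    · exact ⟨-(b - k), by rw [Int.cast_neg, ← h1, h2, neg_neg]⟩

theorem meromorphicAt_eval_inv (P : Polynomial ℂ) :
    MeromorphicAt (fun w : ℂ => P.eval w⁻¹) 0 := by
  induction P using Polynomial.induction_on' with
  | add P Q hP hQ => simpa using hP.fun_add hQ
  | monomial k a =>
    simp only [Polynomial.eval_monomial]
    exact (MeromorphicAt.const a 0).fun_mul ((MeromorphicAt.id (0 : ℂ)).fun_inv.fun_pow k)

section Plane

variable {n : ℕ} {p : Fin n → ℂ} {lam : ℂ → ℝ} {q : ℂ → ℂ} {u : ℂ → ℝ} {β : Fin n → ℝ} {βinf : ℝ}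

/-- The a priori bound `|g / g'|² ≤ 1 / lam`; it holds because `cosh ≥ 1`. -/
theorem IsReciprocalLogDeriv.metric_mul_sq_le {U : Set ℂ} (h : IsReciprocalLogDeriv U lam q u)
    {z : ℂ} (hz : z ∈ U) (hl : 0 < lam z) : lam z * ‖q z‖ ^ 2 ≤ 1 := by
  by_cases hq : q z = 0
  · simp [hq]
  · have h1 := h.metric z hz hq
    have h2 : 1 ≤ Real.cosh (u z) ^ 2 := one_le_pow₀ (Real.one_le_cosh _)
    have h3 : 0 < ‖q z‖ ^ 2 := by positivity
    rw [norm_inv, inv_pow] at h1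
    have h4 : lam z ≤ (‖q z‖ ^ 2)⁻¹ := by
      rw [← h1]; exact le_mul_of_one_le_right hl.le h2
    calc _ ≤ (‖q z‖ ^ 2)⁻¹ * ‖q z‖ ^ 2 := by gcongr
      _ = 1 := inv_mul_cancel₀ h3.ne'

/-- `q` is a rational function: it has polynomial growth at all punctures because
`|q|² ≤ 1 / lam`. -/
theorem IsReciprocalLogDeriv.exists_polynomial
    (h : IsReciprocalLogDeriv (puncturedPlane p) lam q u)
    (hlam : ∀ z ∈ puncturedPlane p, 0 < lam z)
    (hcone : ∀ j, HasConicalSingularityAt lam (p j) (β j))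
    (hconeinf : HasConicalSingularityAtInfty lam βinf) :
    ∃ (N : ℕ) (Q : Polynomial ℂ), ∀ z ∈ puncturedPlane p,
      (∏ j, (z - p j)) ^ N * q z = Q.eval z := by
  obtain ⟨N, hN⟩ : ∃ N : ℕ, ∀ j, β j ≤ N := by
    obtain ⟨x, hx⟩ := (Set.finite_range β).bddAbove
    obtain ⟨N, hN⟩ := exists_nat_ge x
    exact ⟨N, fun j => (hx ⟨j, rfl⟩).trans hN⟩
  set D : ℂ → ℂ := fun z => ∏ j, (z - p j) with hD
  have hDd : Differentiable ℂ D := by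
    refine Differentiable.fun_finsetProd fun j _ => ?_
    exact differentiable_id.sub_const _
  obtain ⟨Φ, hΦ, hΦF⟩ := exists_differentiable_eqOn_compl (Set.finite_range p)
    (F := fun z => D z ^ N * q z)
    (fun z hz => ((hDd z).pow N).mul (h.analyticAt z hz).differentiableAt) (by
      rintro _ ⟨j, rfl⟩
      have hpj := eventually_mem_puncturedPlane p (p j)
      have h1 := (hcone j).isBigO_one (hpj.mono fun z hz => (hlam z hz).le)
        (hpj.mono fun z hz => h.metric_mul_sq_le hz (hlam z hz)) (hN j)
      have h2 : Tendsto (fun z => (z - p j) * (∏ i ∈ Finset.univ.erase j, (z - p i)) ^ N)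
          (𝓝[≠] (p j)) (𝓝 0) := by
        have : Continuous (fun z => (z - p j) * (∏ i ∈ Finset.univ.erase j, (z - p i)) ^ N) := by
          fun_prop
        simpa using (this.tendsto (p j)).mono_left nhdsWithin_le_nhds
      have h3 := h1.mul_isLittleO ((Asymptotics.isLittleO_one_iff ℝ).2 h2)
      simp only [mul_one] at h3
      refine ((Asymptotics.isLittleO_one_iff ℝ).1 h3).congr fun z => ?_
      rw [hD]
      simp only
      rw [← Finset.mul_prod_erase Finset.univ (fun i => z - p i) (Finset.mem_univ j), mul_pow]
      ring)
  obtain ⟨M, hM⟩ := exists_nat_ge βinf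
  have hinf : Tendsto (fun z : ℂ => z⁻¹) (cobounded ℂ) (𝓝[≠] 0) := tendsto_inv₀_cobounded'
  have hpinf : ∀ᶠ w : ℂ in 𝓝[≠] 0, w⁻¹ ∈ puncturedPlane p :=
    (tendsto_inv₀_nhdsNE_zero (α := ℂ)).eventually (eventually_cobounded_mem_puncturedPlane p)
  have hgrow := HasConicalSingularityAt.isBigO_one (q := fun w => w ^ 2 * q w⁻¹) hconeinf
    (hpinf.mono fun w hw => div_nonneg (hlam _ hw).le (by positivity))
    (by
      filter_upwards [hpinf, self_mem_nhdsWithin] with w hw hw0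
      have hw0 : 0 < ‖w‖ := norm_pos_iff.2 hw0
      refine le_trans (le_of_eq ?_) (h.metric_mul_sq_le hw (hlam _ hw))
      rw [norm_mul, norm_pow]
      field_simp) hM
  have hgrow' := hgrow.comp_tendsto hinf
  have hDO : (fun z => D z ^ N) =O[cobounded ℂ] (fun z => z ^ (n * N)) := by
    have h1 : D =O[cobounded ℂ] (fun z => ∏ _j : Fin n, z) := by
      refine Asymptotics.IsBigO.finsetProd fun j _ => ?_
      have : (fun _ : ℂ => p j) =O[cobounded ℂ] (fun z : ℂ => z) := by
        refine (Asymptotics.isLittleO_const_left.2 (Or.inr ?_)).isBigO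
        exact tendsto_norm_cobounded_atTop
      exact (Asymptotics.isBigO_refl _ _).sub this
    simpa [pow_mul] using h1.pow N
  have hne : ∀ᶠ z : ℂ in cobounded ℂ, z ≠ 0 := by
    filter_upwards [(tendsto_norm_cobounded_atTop (E := ℂ)).eventually_gt_atTop 0] with z hz
    simpa using hz
  have hq : q =O[cobounded ℂ] (fun z => z ^ (M + 2)) := by
    have h0 : ((fun w : ℂ => (w - 0) ^ M * (w ^ 2 * q w⁻¹)) ∘ (fun z : ℂ => z⁻¹))
        =O[cobounded ℂ] (fun _ => (1 : ℂ)) :=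
      hgrow'.trans (Asymptotics.isBigO_const_const _ one_ne_zero _)
    refine (h0.mul (Asymptotics.isBigO_refl (fun z : ℂ => z ^ (M + 2)) _)).congr' ?_ (by simp)
    filter_upwards [hne] with z hz
    simp only [Function.comp_apply, sub_zero, inv_inv]
    rw [pow_add, inv_pow, inv_pow]
    field_simp
  obtain ⟨Q, hQ⟩ := exists_polynomial_of_isLittleO_pow (n * N + (M + 2) + 1) Φ hΦ (by
    have h1 : Φ =O[cobounded ℂ] (fun z => z ^ (n * N) * z ^ (M + 2)) := by
      refine (hDO.mul hq).congr' ?_ EventuallyEq.rfl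
      filter_upwards [eventually_cobounded_mem_puncturedPlane p] with z hz
      exact (hΦF z hz).symm
    refine h1.trans_isLittleO ?_
    simp only [← pow_add]
    refine Asymptotics.isLittleO_pow_pow_cobounded_of_lt ?_
    omega)
  exact ⟨N, Q, fun z hz => by rw [← hQ z, hΦF z hz]⟩

theorem eventually_eval_ne_zero {Q : Polynomial ℂ} (hQ : Q ≠ 0) (a : ℂ) :
    ∀ᶠ z in 𝓝[≠] a, Q.eval z ≠ 0 := by
  have h : ((Q.roots.toFinset : Set ℂ) \ {a})ᶜ ∈ 𝓝 a :=
    ((Q.roots.toFinset.finite_toSet).subset Set.sdiff_subset).isClosed.isOpen_compl.mem_nhds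
      (by simp)
  filter_upwards [mem_nhdsWithin_of_mem_nhds h, self_mem_nhdsWithin] with z hz hza hzp
  exact hz ⟨by simpa [hQ] using hzp, hza⟩

theorem eventually_cobounded_eval_ne_zero {Q : Polynomial ℂ} (hQ : Q ≠ 0) :
    ∀ᶠ z in cobounded ℂ, Q.eval z ≠ 0 := by
  filter_upwards [isBounded_def.1 (Q.roots.toFinset.finite_toSet).isBounded] with z hz hzp
  exact hz (by simpa [hQ] using hzp)

/-- The logarithmic derivative `1 / q` of the developing map is `∑ e_a / (z - a)` with real
residues `e_a`, which are integers away from the punctures, and at a puncture exactly when the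
order of the conical singularity is an integer. -/
theorem IsReciprocalLogDeriv.exists_partialFractions
    (h : IsReciprocalLogDeriv (puncturedPlane p) lam q u)
    (hlam : ∀ z ∈ puncturedPlane p, 0 < lam z)
    (hcone : ∀ j, HasConicalSingularityAt lam (p j) (β j))
    (hconeinf : HasConicalSingularityAtInfty lam βinf) :
    ∃ (S : Finset ℂ) (e : ℂ → ℝ), (∀ j, p j ∈ S) ∧
      (∀ a ∈ S, a ∉ Set.range p → e a ∈ Set.range ((↑) : ℤ → ℝ)) ∧
      (∀ j, e (p j) ∈ Set.range ((↑) : ℤ → ℝ) ↔ β j ∈ Set.range ((↑) : ℤ → ℝ)) ∧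
      ∀ z ∉ S, q z ≠ 0 ∧ (q z)⁻¹ = ∑ a ∈ S, (e a : ℂ) / (z - a) := by
  obtain ⟨N, Q, hQ⟩ := h.exists_polynomial hlam hcone hconeinf
  have hprod : ∀ z ∈ puncturedPlane p, (∏ j, (z - p j)) ^ N ≠ 0 := fun z hz =>
    pow_ne_zero _ (Finset.prod_ne_zero_iff.2 fun j _ => sub_ne_zero.2 fun hj => hz ⟨j, hj.symm⟩)
  have hQq : ∀ z ∈ puncturedPlane p, Q.eval z = 0 ↔ q z = 0 := fun z hz => by
    rw [← hQ z hz, mul_eq_zero, or_iff_right (hprod z hz)]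
  have hinv : ∀ z ∈ puncturedPlane p,
      (q z)⁻¹ = (∏ j, (z - p j)) ^ N * (Q.eval z)⁻¹ := fun z hz => by
    rw [← hQ z hz, mul_inv, mul_inv_cancel_left₀ (hprod z hz)]
  have hQ0 : Q ≠ 0 := by
    rintro rfl
    obtain ⟨z, hz⟩ := (eventually_cobounded_mem_puncturedPlane p).exists
    have hzero : q =ᶠ[𝓝 z] fun _ => 0 := by
      filter_upwards [(isOpen_puncturedPlane p).mem_nhds hz] with w hw
      exact (hQq w hw).1 (by simp)
    have hd : deriv q z = 0 := by rw [hzero.deriv_eq]; simp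
    rcases h.deriv_of_eq_zero z hz hzero.eq_of_nhds with h1 | h1 <;> simp [hd] at h1
  -- residues at the punctures
  have hres : ∀ j, ∃ (τ : ℝ) (k : ℤ), β j = |τ| + k ∧
      Tendsto (fun z => (z - p j) * (q z)⁻¹) (𝓝[≠] (p j)) (𝓝 τ) := by
    intro j
    have hne := eventually_eval_ne_zero hQ0 (p j)
    have hpj := eventually_mem_puncturedPlane p (p j)
    refine exists_real_residue (u := u) ?_ ?_ ?_ (hcone j)
    · have h1 : MeromorphicAt (fun z => (∏ i, (z - p i)) ^ N * (Q.eval z)⁻¹) (p j) := by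
        refine (AnalyticAt.meromorphicAt ?_).fun_mul (AnalyticAt.meromorphicAt ?_).fun_inv
        · have : Differentiable ℂ fun z => (∏ i, (z - p i)) ^ N := by fun_prop
          exact this.analyticAt _
        · exact Q.differentiable.analyticAt _
      refine h1.congr ?_
      filter_upwards [hpj] with z hz
      exact (hinv z hz).symm
    · filter_upwards [hne, hpj] with z h1 h2
      exact h.hasFDerivAt z h2 (mt (hQq z h2).2 h1)
    · filter_upwards [hne, hpj] with z h1 h2
      exact h.metric z h2 (mt (hQq z h2).2 h1)
  -- the puncture at infinity, in the coordinate `w = 1 / z`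
  have hinf : Tendsto (fun z => (q z)⁻¹) (cobounded ℂ) (𝓝 0) := by
    have hpinf : ∀ᶠ w : ℂ in 𝓝[≠] 0, w⁻¹ ∈ puncturedPlane p ∧ Q.eval w⁻¹ ≠ 0 :=
      (tendsto_inv₀_nhdsNE_zero (α := ℂ)).eventually
        ((eventually_cobounded_mem_puncturedPlane p).and (eventually_cobounded_eval_ne_zero hQ0))
    obtain ⟨τ, k, -, hτ⟩ := exists_real_residue (p := 0) (u := fun w => u w⁻¹)
      (f := fun w => (q w⁻¹)⁻¹ * -(w ^ 2)⁻¹) (lam := fun w => lam w⁻¹ / ‖w‖ ^ 4) (β := βinf)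
      (by
        have h1 : MeromorphicAt
            (fun w => (∏ i, (w⁻¹ - p i)) ^ N * (Q.eval w⁻¹)⁻¹ * -(w ^ 2)⁻¹) 0 := by
          refine ((MeromorphicAt.fun_pow (MeromorphicAt.fun_prod fun i _ => ?_) N).fun_mul
            (meromorphicAt_eval_inv Q).fun_inv).fun_mul
              (((MeromorphicAt.id (0 : ℂ)).fun_pow 2).fun_inv.fun_neg)
          exact (MeromorphicAt.id (0 : ℂ)).fun_inv.fun_sub (MeromorphicAt.const _ _)
        refine h1.congr ?_
        filter_upwards [hpinf] with w hw
        rw [hinv _ hw.1])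
      (by
        filter_upwards [hpinf, self_mem_nhdsWithin] with w hw hw0
        have h1 := h.hasFDerivAt _ hw.1 (mt (hQq _ hw.1).2 hw.2)
        have h2 := h1.comp w ((hasDerivAt_inv (𝕜 := ℂ) hw0).hasFDerivAt.restrictScalars ℝ)
        refine h2.congr_fderiv ?_
        refine ContinuousLinearMap.ext fun v => ?_
        change ((q w⁻¹)⁻¹ * (v • -(w ^ 2)⁻¹)).re = ((q w⁻¹)⁻¹ * -(w ^ 2)⁻¹ * v).re
        rw [smul_eq_mul, mul_comm v, mul_assoc])
      (by
        filter_upwards [hpinf, self_mem_nhdsWithin] with w hw hw0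
        have hw0 : 0 < ‖w‖ := norm_pos_iff.2 hw0
        have h1 := h.metric _ hw.1 (mt (hQq _ hw.1).2 hw.2)
        rw [norm_mul, mul_pow, ← h1, norm_neg, norm_inv, norm_pow]
        field_simp)
      hconeinf
    have h2 : Tendsto (fun w : ℂ => (q w⁻¹)⁻¹) (𝓝[≠] 0) (𝓝 0) := by
      have h3 : Tendsto (fun w : ℂ => -w) (𝓝[≠] 0) (𝓝 0) := by
        simpa using (continuous_neg.tendsto (0 : ℂ)).mono_left nhdsWithin_le_nhds
      have h4 := h3.mul hτ
      rw [zero_mul] at h4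
      refine h4.congr' ?_
      filter_upwards [self_mem_nhdsWithin] with w hw0
      have hw0 : w ≠ 0 := hw0
      field_simp
      simp
    refine (h2.comp (tendsto_inv₀_cobounded' (α := ℂ))).congr fun z => ?_
    simp
  choose τ k hβ hτ using hres
  classical
  set S : Finset ℂ := Finset.univ.image p ∪ Q.roots.toFinset with hS
  have hSp : ∀ j, p j ∈ S := fun j => by simp [hS]
  have hnotS : ∀ z ∉ S, z ∈ puncturedPlane p ∧ q z ≠ 0 := by
    intro z hz
    simp only [hS, Finset.mem_union, Finset.mem_image, Finset.mem_univ, true_and, not_or,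
      Multiset.mem_toFinset, Polynomial.mem_roots hQ0, Polynomial.IsRoot.def] at hz
    exact ⟨hz.1, mt (hQq z hz.1).2 hz.2⟩
  have hres' : ∀ a ∈ S, ∃ e : ℝ, Tendsto (fun z => (z - a) * (q z)⁻¹) (𝓝[≠] a) (𝓝 e) ∧
      (a ∉ Set.range p → e ∈ Set.range ((↑) : ℤ → ℝ)) := by
    intro a ha
    by_cases hap : a ∈ Set.range p
    · obtain ⟨j, rfl⟩ := hap
      exact ⟨τ j, hτ j, fun hj => absurd ⟨j, rfl⟩ hj⟩
    · have hqa : q a = 0 := by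
        by_contra hqa
        simp only [hS, Finset.mem_union, Finset.mem_image, Finset.mem_univ, true_and,
          Multiset.mem_toFinset, Polynomial.mem_roots hQ0, Polynomial.IsRoot.def] at ha
        exact ha.elim hap (mt (hQq a hap).1 hqa)
      have hd := h.deriv_of_eq_zero a hap hqa
      have hd0 : deriv q a ≠ 0 := by rcases hd with hd | hd <;> simp [hd]
      have h1 := (h.analyticAt a hap).differentiableAt.hasDerivAt.tendsto_slope.inv₀ hd0
      have h2 : Tendsto (fun z => (z - a) * (q z)⁻¹) (𝓝[≠] a) (𝓝 (deriv q a)⁻¹) := by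
        refine h1.congr fun z => ?_
        rw [slope_def_field, hqa, sub_zero, inv_div, div_eq_mul_inv]
      rcases hd with hd | hd
      · exact ⟨1, by simpa [hd] using h2, fun _ => ⟨1, by simp⟩⟩
      · exact ⟨-1, by simpa [hd, inv_neg] using h2, fun _ => ⟨-1, by simp⟩⟩
  choose! e he hez using hres'
  refine ⟨S, e, hSp, hez, fun j => ?_, fun z hz => ⟨(hnotS z hz).2, ?_⟩⟩
  · have : e (p j) = τ j := by
      exact_mod_cast tendsto_nhds_unique (he _ (hSp j)) (hτ j)
    rw [this]
    exact mem_range_intCast_iff_of_eq_abs_add (hβ j)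
  · refine eq_sum_div_of_simple_poles S (fun a => (e a : ℂ)) (fun z hz => ?_) he hinf z hz
    exact (h.analyticAt z (hnotS z hz).1).differentiableAt.inv (hnotS z hz).2

end Plane

/-! ### Homogeneous coordinates on the sphere and commuting elements of SU(2) -/

open Classical in
/-- The point of the Riemann sphere with homogeneous coordinates `[a : b]`
(the point `∞` if `b = 0`, also in the meaningless case `a = b = 0`). -/
def toSphere (a b : ℂ) : OnePoint ℂ := if b = 0 then ∞ else ((a / b : ℂ) : OnePoint ℂ)

theorem toSphere_eq_toSphere_iff {a b c d : ℂ} (h : a ≠ 0 ∨ b ≠ 0) (h' : c ≠ 0 ∨ d ≠ 0) :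
    toSphere a b = toSphere c d ↔ a * d = c * b := by
  unfold toSphere
  split_ifs with hb hd hd
  · simp [hb, hd]
  · have ha : a ≠ 0 := h.resolve_right (not_not.2 hb)
    simp [hb, hd, ha]
  · have hc : c ≠ 0 := h'.resolve_right (not_not.2 hd)
    simp [hb, hd, hc]
  · rw [OnePoint.coe_eq_coe, div_eq_div_iff hb hd]

theorem exists_eq_toSphere (q : OnePoint ℂ) :
    ∃ a b : ℂ, (a ≠ 0 ∨ b ≠ 0) ∧ q = toSphere a b := by
  cases q with
  | infty => exact ⟨1, 0, by simp, by simp [toSphere]⟩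
  | coe z => exact ⟨z, 1, by simp, by simp [toSphere]⟩

theorem coe_eq_toSphere (z : ℂ) : ((z : ℂ) : OnePoint ℂ) = toSphere z 1 := by
  simp [toSphere]

theorem sphereInv_coe_eq_toSphere (z : ℂ) :
    sphereInv ((z : ℂ) : OnePoint ℂ) = toSphere 1 z := by
  simp [toSphere, sphereInv]

namespace SU2

/-- An element of `SU(2)` has rows `(α, γ)` and `(-γ̄, ᾱ)`. -/
theorem star_entries (a : SU2) : a.1 1 1 = star (a.1 0 0) ∧ a.1 1 0 = -star (a.1 0 1) := by
  have h := Matrix.mem_specialUnitaryGroup_iff.1 a.2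
  have h1 : star a.1 * a.1 = 1 := (Matrix.mem_unitaryGroup_iff').1 h.1
  have h2 : star a.1 = a.1.adjugate := by
    have h3 : a.1 * a.1.adjugate = 1 := by rw [Matrix.mul_adjugate, h.2, one_smul]
    calc star a.1 = star a.1 * (a.1 * a.1.adjugate) := by rw [h3, mul_one]
      _ = a.1.adjugate := by rw [← mul_assoc, h1, one_mul]
  rw [Matrix.adjugate_fin_two] at h2
  have h00 := congr_fun₂ h2 0 0
  have h10 := congr_fun₂ h2 1 0
  simp [Matrix.star_apply] at h00 h10
  exact ⟨by simp [← h00], by simp [h10]⟩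

theorem det_eq (a : SU2) : a.1 0 0 * a.1 1 1 - a.1 0 1 * a.1 1 0 = 1 := by
  rw [← Matrix.det_fin_two]
  exact (Matrix.mem_specialUnitaryGroup_iff.1 a.2).2

theorem norm_sq_add_norm_sq (a : SU2) (x y : ℂ) :
    ‖a.1 0 0 * x + a.1 0 1 * y‖ ^ 2 + ‖a.1 1 0 * x + a.1 1 1 * y‖ ^ 2 = ‖x‖ ^ 2 + ‖y‖ ^ 2 := by
  have hd := det_eq a
  obtain ⟨h1, h2⟩ := star_entries a
  rw [h1, h2] at hd ⊢
  have key : ∀ z : ℂ, ((‖z‖ ^ 2 : ℝ) : ℂ) = z * star z := fun z => by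
    rw [← Complex.normSq_eq_norm_sq]
    exact (Complex.mul_conj z).symm
  apply Complex.ofReal_injective
  push_cast [← Complex.ofReal_pow]
  rw [key, key, key, key]
  simp only [star_add, star_mul', star_neg, star_star]
  linear_combination (x * star x + y * star y) * hd

theorem apply_ne_zero (a : SU2) {x y : ℂ} (h : x ≠ 0 ∨ y ≠ 0) :
    a.1 0 0 * x + a.1 0 1 * y ≠ 0 ∨ a.1 1 0 * x + a.1 1 1 * y ≠ 0 := by
  by_contra! hc
  have := norm_sq_add_norm_sq a x y
  rw [hc.1, hc.2] at this
  simp only [norm_zero, ne_eq, OfNat.ofNat_ne_zero, not_false_eq_true, zero_pow, add_zero] at this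
  have hx : ‖x‖ ^ 2 = 0 := by nlinarith [sq_nonneg ‖x‖, sq_nonneg ‖y‖]
  have hy : ‖y‖ ^ 2 = 0 := by nlinarith [sq_nonneg ‖x‖, sq_nonneg ‖y‖]
  simp at hx hy
  tauto

/-- In homogeneous coordinates, the Möbius action is the linear action of the matrix. -/
theorem moebius_toSphere (a : SU2) {x y : ℂ} (h : x ≠ 0 ∨ y ≠ 0) :
    moebius a (toSphere x y)
      = toSphere (a.1 0 0 * x + a.1 0 1 * y) (a.1 1 0 * x + a.1 1 1 * y) := by
  unfold moebius
  by_cases hy : y = 0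
  · have hx : x ≠ 0 := h.resolve_right (not_not.2 hy)
    simp only [toSphere, hy, if_true, OnePoint.smul_infty_eq_ite, mul_zero, add_zero, mul_eq_zero,
      hx, or_false]
    change (if a.1 1 0 = 0 then _ else ((a.1 0 0 / a.1 1 0 : ℂ) : OnePoint ℂ)) = _
    split_ifs with h1
    · rfl
    · rw [mul_div_mul_right _ _ hx]
  · simp only [toSphere, hy, if_false, OnePoint.smul_some_eq_ite]
    change (if a.1 1 0 * (x / y) + a.1 1 1 = 0 then _ else
      (((a.1 0 0 * (x / y) + a.1 0 1) / (a.1 1 0 * (x / y) + a.1 1 1) : ℂ) : OnePoint ℂ)) = _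
    have e1 : a.1 1 0 * x + a.1 1 1 * y = (a.1 1 0 * (x / y) + a.1 1 1) * y := by
      field_simp
    have e2 : a.1 0 0 * x + a.1 0 1 * y = (a.1 0 0 * (x / y) + a.1 0 1) * y := by
      field_simp
    rw [e1, e2]
    simp only [mul_eq_zero, hy, or_false]
    split_ifs with h1
    · rfl
    · rw [mul_div_mul_right _ _ hy]

/-- Matrix with rows `(x, y)` and `(-ȳ, x̄)`. -/
def ofUnitRow (x y : ℂ) (h : x * star x + y * star y = 1) : SU2 :=
  ⟨!![x, y; -star y, star x], by
    rw [Matrix.mem_specialUnitaryGroup_iff, Matrix.mem_unitaryGroup_iff]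
    constructor
    · ext i j
      fin_cases i <;> fin_cases j <;>
        simp [Matrix.mul_apply, Matrix.star_apply, Fin.sum_univ_two] at h ⊢ <;>
        first | ring1 | linear_combination h
    · rw [Matrix.det_fin_two_of]
      linear_combination h⟩

/-- Commuting elements of `SU(2)` are simultaneously diagonalizable by an element of `SU(2)`.
Vanishing of the upper right entry suffices, since an upper right zero of a unitary matrix of
determinant one forces the lower left entry to vanish, too. -/
theorem exists_conj_diagonal (G : Set SU2) (hG : ∀ a ∈ G, ∀ b ∈ G, a * b = b * a) :
    ∃ a : SU2, ∀ s ∈ G, (a * s * a⁻¹).1 0 1 = 0 := by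
  by_cases hdiag : ∀ s ∈ G, s.1 0 1 = 0
  · exact ⟨1, fun s hs => by simpa using hdiag s hs⟩
  push Not at hdiag
  obtain ⟨s, hs, hs01⟩ := hdiag
  have hs10 : s.1 1 0 ≠ 0 := by
    rw [(star_entries s).2]
    simpa using hs01
  -- `(r₀, r₁)` is a left eigenvector of `s` for the eigenvalue `μ`
  obtain ⟨μ, hμ⟩ : ∃ μ : ℂ, μ ^ 2 - (s.1 0 0 + s.1 1 1) * μ + 1 = 0 := by
    obtain ⟨d, hd⟩ := IsAlgClosed.exists_pow_nat_eq ((s.1 0 0 + s.1 1 1) ^ 2 - 4) two_pos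
    exact ⟨(s.1 0 0 + s.1 1 1 + d) / 2, by linear_combination hd / 4⟩
  set r₀ := s.1 1 0 with hr₀
  set r₁ := μ - s.1 0 0 with hr₁
  have hNpos : 0 < ‖r₀‖ ^ 2 + ‖r₁‖ ^ 2 := by positivity
  set N : ℝ := Real.sqrt (‖r₀‖ ^ 2 + ‖r₁‖ ^ 2) with hN
  have hN0 : (N : ℂ) ≠ 0 := by
    exact_mod_cast (Real.sqrt_pos.2 hNpos).ne'
  have key : ∀ z : ℂ, ((‖z‖ ^ 2 : ℝ) : ℂ) = z * star z := fun z => by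
    rw [← Complex.normSq_eq_norm_sq]
    exact (Complex.mul_conj z).symm
  have hN2 : (N : ℂ) * N = r₀ * star r₀ + r₁ * star r₁ := by
    rw [← key, ← key, ← Complex.ofReal_mul, Real.mul_self_sqrt hNpos.le]
    push_cast
    rfl
  have hstarN : star (N : ℂ) = N := Complex.conj_ofReal N
  have hunit : r₀ / N * star (r₀ / N) + r₁ / N * star (r₁ / N) = 1 := by
    rw [star_div₀, star_div₀, hstarN]
    field_simp
    linear_combination -hN2
  refine ⟨ofUnitRow (r₀ / N) (r₁ / N) hunit, fun t ht => ?_⟩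
  have hcomm : s.1 * t.1 = t.1 * s.1 := congrArg Subtype.val (hG s hs t ht)
  have h00 := congr_fun₂ hcomm 0 0
  have h10 := congr_fun₂ hcomm 1 0
  simp only [Matrix.mul_apply, Fin.sum_univ_two] at h00 h10
  have hds := det_eq s
  have hinv : (ofUnitRow (r₀ / N) (r₁ / N) hunit)⁻¹.1
      = star (ofUnitRow (r₀ / N) (r₁ / N) hunit).1 := rfl
  rw [Submonoid.coe_mul, Submonoid.coe_mul, hinv]
  simp only [ofUnitRow, Matrix.mul_apply, Fin.sum_univ_two, Matrix.star_apply, Matrix.of_apply,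
    Matrix.cons_val_zero, Matrix.cons_val_one, Matrix.cons_val', Matrix.cons_val_fin_one,
    star_neg, star_star]
  field_simp
  rw [hr₁, hr₀]
  linear_combination -(μ - s.1 0 0) * h10 - s.1 1 0 * h00 - t.1 1 0 * hμ - t.1 1 0 * hds

end SU2

/-! ### Branches of developing maps in homogeneous coordinates -/

/-- The Wronskian `h₁' h₂ - h₁ h₂'`. -/
def wronskian (h₁ h₂ : ℂ → ℂ) (z : ℂ) : ℂ := deriv h₁ z * h₂ z - h₁ z * deriv h₂ z

section Wronskian

variable {h₁ h₂ k₁ k₂ : ℂ → ℂ} {z : ℂ}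

theorem analyticAt_wronskian (h1 : AnalyticAt ℂ h₁ z) (h2 : AnalyticAt ℂ h₂ z) :
    AnalyticAt ℂ (wronskian h₁ h₂) z :=
  (h1.deriv.mul h2).sub (h1.mul h2.deriv)

/-- If `[k₁ : k₂] = [χ h₁ : h₂]` near `z`, then the values at `z` are proportional, with factor
`l`, and the Wronskians are related by the factor `l² χ`. -/
theorem exists_wronskian_eq (h1 : DifferentiableAt ℂ h₁ z) (h2 : DifferentiableAt ℂ h₂ z)
    (k1 : DifferentiableAt ℂ k₁ z) (k2 : DifferentiableAt ℂ k₂ z)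
    (h0 : h₁ z ≠ 0 ∨ h₂ z ≠ 0) (k0 : k₁ z ≠ 0 ∨ k₂ z ≠ 0) {χ : ℂ} (hχ : χ ≠ 0)
    (hrel : ∀ᶠ w in 𝓝 z, k₁ w * h₂ w = χ * h₁ w * k₂ w) :
    ∃ l : ℂ, l ≠ 0 ∧ k₁ z = l * χ * h₁ z ∧ k₂ z = l * h₂ z ∧
      wronskian k₁ k₂ z = l ^ 2 * χ * wronskian h₁ h₂ z := by
  have e0 := hrel.self_of_nhds
  have e1 : deriv k₁ z * h₂ z + k₁ z * deriv h₂ z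
      = χ * deriv h₁ z * k₂ z + χ * h₁ z * deriv k₂ z := by
    have a := (k1.hasDerivAt.mul h2.hasDerivAt)
    have b := ((h1.hasDerivAt.const_mul χ).mul k2.hasDerivAt)
    exact a.unique (b.congr_of_eventuallyEq hrel)
  obtain ⟨l, hl, hl1, hl2⟩ : ∃ l : ℂ, l ≠ 0 ∧ k₁ z = l * χ * h₁ z ∧ k₂ z = l * h₂ z := by
    by_cases hh : h₂ z = 0
    · have hh1 : h₁ z ≠ 0 := h0.resolve_right (not_not.2 hh)
      have hk2 : k₂ z = 0 := by
        rw [hh, mul_zero] at e0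
        simpa [hχ, hh1] using e0.symm
      refine ⟨k₁ z / (χ * h₁ z), ?_, ?_, by rw [hh, hk2, mul_zero]⟩
      · exact div_ne_zero (k0.resolve_right (not_not.2 hk2)) (mul_ne_zero hχ hh1)
      · field_simp
    · have hk2 : k₂ z ≠ 0 := by
        intro hk
        rw [hk, mul_zero] at e0
        exact k0.elim (fun h => h ((mul_eq_zero.1 e0).resolve_right hh)) (fun h => h hk)
      refine ⟨k₂ z / h₂ z, div_ne_zero hk2 hh, ?_, by field_simp⟩
      field_simp
      linear_combination e0
  refine ⟨l, hl, hl1, hl2, ?_⟩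
  unfold wronskian
  rw [hl1, hl2] at e1 ⊢
  linear_combination l * e1

end Wronskian

section Cover

variable {U : Set ℂ} {z₀ : U}

/-- `[h₁ : h₂]` represents `g` near the point `x` of the universal cover in homogeneous
coordinates. -/
structure IsHomBranch (g : UniversalCover U z₀ → OnePoint ℂ) (x : UniversalCover U z₀)
    (h₁ h₂ : ℂ → ℂ) : Prop where
  fst : AnalyticAt ℂ h₁ (x.1 : ℂ)
  snd : AnalyticAt ℂ h₂ (x.1 : ℂ)
  ne_zero : h₁ x.1 ≠ 0 ∨ h₂ x.1 ≠ 0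
  isLocalBranch : IsLocalBranch g x (fun w => toSphere (h₁ w) (h₂ w))

variable {g : UniversalCover U z₀ → OnePoint ℂ} {x y : UniversalCover U z₀}

theorem exists_path_dist_lt (hU : IsOpen U) (z : U) {ε : ℝ} (hε : 0 < ε) :
    ∀ᶠ w in 𝓝 (z : ℂ), ∃ (hw : w ∈ U) (δ : Path z ⟨w, hw⟩), ∀ t, dist (δ t) z < ε := by
  obtain ⟨r, hr, hrU⟩ := Metric.isOpen_iff.1 hU z z.2
  have hR : 0 < min r ε := lt_min hr hε
  filter_upwards [Metric.ball_mem_nhds (z : ℂ) hR] with w hw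
  have hmem : ∀ t : unitInterval, AffineMap.lineMap (z : ℂ) w (t : ℝ) ∈
      Metric.ball (z : ℂ) (min r ε) := fun t =>
    (convex_ball (z : ℂ) _).segment_subset (Metric.mem_ball_self hR) hw (by
      rw [segment_eq_image_lineMap]
      exact ⟨t, t.2, rfl⟩)
  have hball : Metric.ball (z : ℂ) (min r ε) ⊆ U :=
    (Metric.ball_subset_ball (min_le_left _ _)).trans hrU
  refine ⟨hball hw, ⟨⟨fun t => ⟨AffineMap.lineMap (z : ℂ) w (t : ℝ), hball (hmem t)⟩, ?_⟩, ?_, ?_⟩,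
    fun t => ?_⟩
  · refine Continuous.subtype_mk ?_ _
    exact AffineMap.lineMap_continuous.comp continuous_subtype_val
  · exact Subtype.ext (by simp)
  · exact Subtype.ext (by simp)
  · exact lt_of_lt_of_le (hmem t) (min_le_right _ _)

/-- The point of the universal cover obtained by prolonging the path class `x` by `δ`. -/
def UniversalCover.extend {X : Type*} [TopologicalSpace X] {x₀ : X} (x : UniversalCover X x₀)
    {w : X} (δ : Path x.1 w) : UniversalCover X x₀ :=
  ⟨w, Path.Homotopic.Quotient.trans x.2 (Path.Homotopic.Quotient.mk δ)⟩

theorem UniversalCover.extend_trans {X : Type*} [TopologicalSpace X] {x₀ : X}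
    (x : UniversalCover X x₀) {w v : X} (δ : Path x.1 w) (δ' : Path w v) :
    UniversalCover.extend (UniversalCover.extend x δ) δ' =
      UniversalCover.extend x (δ.trans δ') := by
  unfold UniversalCover.extend
  rw [Path.Homotopic.Quotient.mk_trans, Path.Homotopic.Quotient.trans_assoc]

theorem UniversalCover.extend_refl {X : Type*} [TopologicalSpace X] {x₀ : X}
    (x : UniversalCover X x₀) : UniversalCover.extend x (Path.refl x.1) = x := by
  unfold UniversalCover.extend
  rw [Path.Homotopic.Quotient.mk_refl, Path.Homotopic.Quotient.trans_refl]

/-- A local branch stays a local branch when the point moves along a short path. -/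
theorem IsLocalBranch.extend {F : ℂ → OnePoint ℂ} {ε : ℝ}
    (hF : ∀ (w : U) (δ : Path x.1 w), (∀ t, dist (δ t) x.1 < ε) → g (x.extend δ) = F w)
    {w : U} {δ : Path x.1 w} (hδ : ∀ t, dist (δ t) x.1 < ε) :
    IsLocalBranch g (x.extend δ) F := by
  have hw : dist w x.1 < ε := by simpa using hδ 1
  refine ⟨ε - dist w x.1, sub_pos.2 hw,
    fun v (δ' : Path w v) (hδ' : ∀ t, dist (δ' t) w < ε - dist w x.1) => ?_⟩
  change g (UniversalCover.extend (UniversalCover.extend x δ) δ') = F v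
  rw [UniversalCover.extend_trans]
  refine hF v (δ.trans δ') fun t => ?_
  rw [Path.trans_apply]
  split_ifs
  · exact hδ _
  · have h1 := hδ' ⟨2 * (t : ℝ) - 1, by constructor <;> linarith [t.2.1, t.2.2]⟩
    exact (dist_triangle _ w _).trans_lt (by linarith)

theorem IsLocalBranch.eventually_extend (hU : IsOpen U) {F : ℂ → OnePoint ℂ}
    (hF : IsLocalBranch g x F) :
    ∀ᶠ w in 𝓝 (x.1 : ℂ), ∃ y : UniversalCover U z₀, (y.1 : ℂ) = w ∧ IsLocalBranch g y F := by
  obtain ⟨ε, hε, hF⟩ := hF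
  filter_upwards [exists_path_dist_lt hU x.1 hε] with w ⟨hw, δ, hδ⟩
  exact ⟨x.extend δ, rfl, IsLocalBranch.extend hF hδ⟩

theorem IsLocalBranch.apply_self {F : ℂ → OnePoint ℂ} (hF : IsLocalBranch g x F) :
    g x = F x.1 := by
  obtain ⟨ε, hε, hF⟩ := hF
  have := hF x.1 (Path.refl _) (by simpa using hε)
  rw [← this]
  exact congrArg g (UniversalCover.extend_refl x).symm

theorem IsLocalBranch.eventuallyEq (hU : IsOpen U) {F G : ℂ → OnePoint ℂ}
    (hF : IsLocalBranch g x F) (hG : IsLocalBranch g x G) : F =ᶠ[𝓝 (x.1 : ℂ)] G := by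
  obtain ⟨ε, hε, hF⟩ := hF
  obtain ⟨ε', hε', hG⟩ := hG
  filter_upwards [exists_path_dist_lt hU x.1 (lt_min hε hε')] with w ⟨hw, δ, hδ⟩
  rw [← hF ⟨w, hw⟩ δ fun t => (hδ t).trans_le (min_le_left _ _),
    ← hG ⟨w, hw⟩ δ fun t => (hδ t).trans_le (min_le_right _ _)]

theorem IsHomBranch.eventually_ne_zero {h₁ h₂ : ℂ → ℂ} (h : IsHomBranch g x h₁ h₂) :
    ∀ᶠ w in 𝓝 (x.1 : ℂ), h₁ w ≠ 0 ∨ h₂ w ≠ 0 := by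
  rcases h.ne_zero with h0 | h0
  · exact (h.fst.continuousAt.eventually_ne h0).mono fun _ => Or.inl
  · exact (h.snd.continuousAt.eventually_ne h0).mono fun _ => Or.inr

theorem IsHomBranch.eventually_extend (hU : IsOpen U) {h₁ h₂ : ℂ → ℂ}
    (h : IsHomBranch g x h₁ h₂) :
    ∀ᶠ w in 𝓝 (x.1 : ℂ), ∃ y : UniversalCover U z₀, (y.1 : ℂ) = w ∧ IsHomBranch g y h₁ h₂ := by
  filter_upwards [h.isLocalBranch.eventually_extend hU, h.fst.eventually_analyticAt,
    h.snd.eventually_analyticAt, h.eventually_ne_zero] with w ⟨y, hy, hyF⟩ h1 h2 h3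
  subst hy
  exact ⟨y, rfl, h1, h2, h3, hyF⟩

theorem IsHomBranch.of_isLocalBranch_coe {h : ℂ → ℂ} (ha : AnalyticAt ℂ h (x.1 : ℂ))
    (hb : IsLocalBranch g x (fun w => ((h w : ℂ) : OnePoint ℂ))) :
    IsHomBranch g x h (fun _ => 1) :=
  ⟨ha, analyticAt_const, by simp, by simpa only [coe_eq_toSphere] using hb⟩

theorem IsHomBranch.of_isLocalBranch_inv {h : ℂ → ℂ} (ha : AnalyticAt ℂ h (x.1 : ℂ))
    (hb : IsLocalBranch g x (fun w => sphereInv ((h w : ℂ) : OnePoint ℂ))) :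
    IsHomBranch g x (fun _ => 1) h :=
  ⟨analyticAt_const, ha, by simp, by simpa only [sphereInv_coe_eq_toSphere] using hb⟩

theorem IsLocalBranch.congr {F G : ℂ → OnePoint ℂ} (hF : IsLocalBranch g x F)
    (h : F =ᶠ[𝓝 (x.1 : ℂ)] G) : IsLocalBranch g x G := by
  obtain ⟨ε, hε, hF⟩ := hF
  obtain ⟨ε', hε', h⟩ := Metric.eventually_nhds_iff.1 h
  refine ⟨min ε ε', lt_min hε hε', fun w δ hδ => ?_⟩
  rw [hF w δ fun t => (hδ t).trans_le (min_le_left _ _)]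
  refine h ?_
  have := hδ 1
  rw [δ.target] at this
  exact this.trans_le (min_le_right _ _)

/-- The defining property of developing maps in homogeneous coordinates. -/
theorem isDevelopingMap_iff {lam : ℂ → ℝ} :
    IsDevelopingMap lam g ↔ ∀ x : UniversalCover U z₀, ∃ h₁ h₂ : ℂ → ℂ, IsHomBranch g x h₁ h₂ ∧
      4 * ‖wronskian h₁ h₂ x.1‖ ^ 2 / (‖h₁ x.1‖ ^ 2 + ‖h₂ x.1‖ ^ 2) ^ 2 = lam x.1 := by
  constructor
  · intro hg x
    obtain ⟨h, ha, hb | hb, hm⟩ := hg x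
    · refine ⟨h, _, IsHomBranch.of_isLocalBranch_coe ha hb, ?_⟩
      rw [← hm]
      simp [wronskian, add_comm]
    · refine ⟨_, h, IsHomBranch.of_isLocalBranch_inv ha hb, ?_⟩
      rw [← hm]
      simp [wronskian]
  · intro hg x
    obtain ⟨h₁, h₂, hb, hm⟩ := hg x
    by_cases h0 : h₂ x.1 = 0
    · have h1 : h₁ x.1 ≠ 0 := hb.ne_zero.resolve_right (not_not.2 h0)
      refine ⟨fun w => h₂ w / h₁ w, hb.snd.div hb.fst h1, Or.inr ?_, ?_⟩
      · refine hb.isLocalBranch.congr ?_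
        filter_upwards [hb.fst.continuousAt.eventually_ne h1, hb.eventually_ne_zero] with w hw hw'
        rw [sphereInv_coe_eq_toSphere, toSphere_eq_toSphere_iff hw' (by simp)]
        field_simp
      · rw [← hm, (hb.snd.differentiableAt.hasDerivAt.fun_div hb.fst.differentiableAt.hasDerivAt
          h1).deriv, h0]
        simp only [wronskian, h0]
        have : ‖h₁ x.1‖ ≠ 0 := norm_ne_zero_iff.2 h1
        simp only [mul_zero, zero_mul, sub_zero, zero_sub, norm_div, norm_mul, norm_pow, norm_zero,
          norm_neg]
        field_simp
    · refine ⟨fun w => h₁ w / h₂ w, hb.fst.div hb.snd h0, Or.inl ?_, ?_⟩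
      · refine hb.isLocalBranch.congr ?_
        filter_upwards [hb.snd.continuousAt.eventually_ne h0] with w hw
        simp [toSphere, hw]
      · rw [← hm, (hb.fst.differentiableAt.hasDerivAt.fun_div hb.snd.differentiableAt.hasDerivAt
          h0).deriv]
        have : ‖h₂ x.1‖ ≠ 0 := norm_ne_zero_iff.2 h0
        change _ = 4 * ‖_ - _‖ ^ 2 / _
        simp only [norm_div, norm_pow]
        field_simp
        ring_nf

/-- The metric can be computed from any branch. -/
theorem IsHomBranch.metric_eq (hU : IsOpen U) {lam : ℂ → ℝ} (hg : IsDevelopingMap lam g)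
    {k₁ k₂ : ℂ → ℂ} (hk : IsHomBranch g x k₁ k₂) :
    4 * ‖wronskian k₁ k₂ x.1‖ ^ 2 / (‖k₁ x.1‖ ^ 2 + ‖k₂ x.1‖ ^ 2) ^ 2 = lam x.1 := by
  obtain ⟨h₁, h₂, hb, hm⟩ := (isDevelopingMap_iff).1 hg x
  have hrel : ∀ᶠ w in 𝓝 (x.1 : ℂ), k₁ w * h₂ w = 1 * h₁ w * k₂ w := by
    filter_upwards [hb.isLocalBranch.eventuallyEq hU hk.isLocalBranch, hb.eventually_ne_zero,
      hk.eventually_ne_zero] with w h1 h2 h3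
    rw [one_mul, ((toSphere_eq_toSphere_iff h2 h3).1 h1)]
  obtain ⟨l, hl, e1, e2, e3⟩ := exists_wronskian_eq hb.fst.differentiableAt
    hb.snd.differentiableAt hk.fst.differentiableAt hk.snd.differentiableAt hb.ne_zero hk.ne_zero
    one_ne_zero hrel
  rw [← hm, e1, e2, e3]
  have hl' : ‖l‖ ≠ 0 := norm_ne_zero_iff.2 hl
  simp only [norm_mul, norm_pow, mul_one, mul_pow]
  rw [← mul_add, mul_pow]
  field_simp

theorem IsHomBranch.wronskian_ne_zero (hU : IsOpen U) {lam : ℂ → ℝ} (hg : IsDevelopingMap lam g)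
    {k₁ k₂ : ℂ → ℂ} (hk : IsHomBranch g x k₁ k₂) (hlam : 0 < lam x.1) :
    wronskian k₁ k₂ x.1 ≠ 0 := by
  intro h0
  have := hk.metric_eq hU hg
  simp [h0] at this
  linarith

end Cover

/-! ### Normalized monodromy and single-valued invariants -/

theorem isPathConnected_puncturedPlane {n : ℕ} (p : Fin n → ℂ) :
    IsPathConnected (puncturedPlane p) :=
  (Set.finite_range p).countable.isPathConnected_compl_of_one_lt_rank
    (by rw [Complex.rank_real_complex]; exact Nat.one_lt_ofNat)

/-- The monodromy of `g` consists of rotations `q ↦ χ q`, `|χ| = 1`, of the sphere. -/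
def HasRotationMonodromy {X : Type*} [TopologicalSpace X] {x₀ : X}
    (g : UniversalCover X x₀ → OnePoint ℂ) : Prop :=
  ∀ T : FundamentalGroup X x₀, ∃ χ : ℂ, ‖χ‖ = 1 ∧ ∀ (x : UniversalCover X x₀) (a b : ℂ),
    (a ≠ 0 ∨ b ≠ 0) → g x = toSphere a b → g (deck T⁻¹ x) = toSphere (χ * a) b

/-- The deck transformations act transitively on the fibres of the universal cover. -/
theorem exists_deck_eq {X : Type*} [TopologicalSpace X] {x₀ : X} {x y : UniversalCover X x₀}
    (h : x.1 = y.1) : ∃ T : FundamentalGroup X x₀, y = deck T⁻¹ x := by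
  obtain ⟨a, P⟩ := x
  obtain ⟨b, Q⟩ := y
  obtain rfl : a = b := h
  refine ⟨(FundamentalGroup.fromPath (Q.trans P.symm))⁻¹, ?_⟩
  rw [inv_inv]
  unfold deck
  congr 1
  change Q = (Q.trans P.symm).trans P
  rw [Path.Homotopic.Quotient.trans_assoc, Path.Homotopic.Quotient.symm_trans,
    Path.Homotopic.Quotient.trans_refl]

theorem deck_extend {X : Type*} [TopologicalSpace X] {x₀ : X} (T : FundamentalGroup X x₀)
    (x : UniversalCover X x₀) {w : X} (δ : Path x.1 w) :
    UniversalCover.extend (deck T x) δ = deck T (x.extend δ) := by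
  unfold UniversalCover.extend deck
  rw [Path.Homotopic.Quotient.trans_assoc]

section Conj

variable {U : Set ℂ} {z₀ : U} {g : UniversalCover U z₀ → OnePoint ℂ} {lam : ℂ → ℝ}

/-- The Fubini-Study metric is invariant under `SU(2)`: the matrix preserves the norm of the
homogeneous coordinates, and the Wronskian is multiplied by its determinant. -/
theorem IsDevelopingMap.moebius (hg : IsDevelopingMap lam g) (a : SU2) :
    IsDevelopingMap lam (fun x => SU2.moebius a (g x)) := by
  rw [isDevelopingMap_iff] at hg ⊢
  intro x
  obtain ⟨h₁, h₂, hb, hm⟩ := hg x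
  refine ⟨fun w => a.1 0 0 * h₁ w + a.1 0 1 * h₂ w, fun w => a.1 1 0 * h₁ w + a.1 1 1 * h₂ w,
    ⟨(analyticAt_const.mul hb.fst).add (analyticAt_const.mul hb.snd),
      (analyticAt_const.mul hb.fst).add (analyticAt_const.mul hb.snd),
      SU2.apply_ne_zero a hb.ne_zero, ?_⟩, ?_⟩
  · have h1 : IsLocalBranch (fun x => SU2.moebius a (g x)) x
        (fun w => SU2.moebius a (toSphere (h₁ w) (h₂ w))) := by
      obtain ⟨ε, hε, h⟩ := hb.isLocalBranch
      exact ⟨ε, hε, fun w δ hδ => congrArg _ (h w δ hδ)⟩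
    refine h1.congr ?_
    filter_upwards [hb.eventually_ne_zero] with w hw
    exact SU2.moebius_toSphere a hw
  · have d : ∀ c d : ℂ, deriv (fun w => c * h₁ w + d * h₂ w) x.1
        = c * deriv h₁ x.1 + d * deriv h₂ x.1 := fun c d =>
      ((hb.fst.differentiableAt.hasDerivAt.const_mul c).add
        (hb.snd.differentiableAt.hasDerivAt.const_mul d)).deriv
    rw [← hm, SU2.norm_sq_add_norm_sq]
    congr 4
    unfold wronskian
    rw [d, d]
    linear_combination (deriv h₁ x.1 * h₂ x.1 - h₁ x.1 * deriv h₂ x.1) * SU2.det_eq a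

/-- The developing map of a reducible metric can be normalized such that its monodromy consists
of rotations about `0` and `∞`. -/
theorem IsReducible.exists_rotationMonodromy (h : IsReducible lam U z₀) :
    ∃ g : UniversalCover U z₀ → OnePoint ℂ, IsDevelopingMap lam g ∧ HasRotationMonodromy g := by
  obtain ⟨g, ρ, hg, hρ, hcomm⟩ := h
  obtain ⟨a, ha⟩ := SU2.exists_conj_diagonal (ρ.range : Set SU2) hcomm
  refine ⟨fun x => SU2.moebius a (g x), hg.moebius a, fun T => ?_⟩
  set s := a * ρ T * a⁻¹ with hs
  have hs01 : s.1 0 1 = 0 := ha _ ⟨T, rfl⟩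
  obtain ⟨h11, h10⟩ := SU2.star_entries s
  rw [hs01, star_zero, neg_zero] at h10
  have hdet := SU2.det_eq s
  rw [hs01, zero_mul, sub_zero, h11] at hdet
  have hnorm : ‖s.1 0 0‖ = 1 := by
    have := congrArg norm hdet
    rw [norm_mul, norm_star, norm_one, ← sq] at this
    exact (pow_eq_one_iff_of_nonneg (norm_nonneg _) two_ne_zero).1 this
  have hs0 : s.1 0 0 ≠ 0 := norm_ne_zero_iff.1 (by rw [hnorm]; exact one_ne_zero)
  refine ⟨s.1 0 0 * s.1 0 0, by rw [norm_mul, hnorm, one_mul], fun x X Y hXY hx => ?_⟩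
  obtain ⟨v, w, hvw, hgx⟩ := exists_eq_toSphere (g x)
  have hmul : a * ρ T = s * a := by rw [hs, inv_mul_cancel_right]
  have hmat : a.1 * (ρ T).1 = s.1 * a.1 := congrArg Subtype.val hmul
  have e00 := congr_fun₂ hmat 0 0
  have e01 := congr_fun₂ hmat 0 1
  have e10 := congr_fun₂ hmat 1 0
  have e11 := congr_fun₂ hmat 1 1
  simp only [Matrix.mul_apply, Fin.sum_univ_two, hs01, h10, h11] at e00 e01 e10 e11
  simp only at hx ⊢
  rw [hρ T x, hgx, SU2.moebius_toSphere _ hvw,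
    SU2.moebius_toSphere _ (SU2.apply_ne_zero _ hvw), toSphere_eq_toSphere_iff
      (SU2.apply_ne_zero _ (SU2.apply_ne_zero _ hvw))
      (hXY.imp_left (mul_ne_zero (mul_ne_zero hs0 hs0)))]
  rw [hgx, SU2.moebius_toSphere _ hvw, toSphere_eq_toSphere_iff (SU2.apply_ne_zero _ hvw) hXY] at hx
  have r1 : a.1 0 0 * ((ρ T).1 0 0 * v + (ρ T).1 0 1 * w)
      + a.1 0 1 * ((ρ T).1 1 0 * v + (ρ T).1 1 1 * w)
      = s.1 0 0 * (a.1 0 0 * v + a.1 0 1 * w) := by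
    linear_combination v * e00 + w * e01
  have r2 : a.1 1 0 * ((ρ T).1 0 0 * v + (ρ T).1 0 1 * w)
      + a.1 1 1 * ((ρ T).1 1 0 * v + (ρ T).1 1 1 * w)
      = star (s.1 0 0) * (a.1 1 0 * v + a.1 1 1 * w) := by
    linear_combination v * e10 + w * e11
  rw [r1, r2]
  linear_combination s.1 0 0 * hx - s.1 0 0 * X * (a.1 1 0 * v + a.1 1 1 * w) * hdet

/-- Branches of `g` at two points over the same point of `U` differ by a unimodular factor. -/
theorem HasRotationMonodromy.exists_mul_eq (hU : IsOpen U) (hg : HasRotationMonodromy g)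
    {x y : UniversalCover U z₀} (hxy : x.1 = y.1) {h₁ h₂ k₁ k₂ : ℂ → ℂ}
    (hh : IsHomBranch g x h₁ h₂) (hk : IsHomBranch g y k₁ k₂) :
    ∃ χ : ℂ, ‖χ‖ = 1 ∧ ∀ᶠ w in 𝓝 (x.1 : ℂ), k₁ w * h₂ w = χ * h₁ w * k₂ w := by
  obtain ⟨T, rfl⟩ := exists_deck_eq hxy
  obtain ⟨χ, hχ, hT⟩ := hg T
  have hχ0 : χ ≠ 0 := norm_ne_zero_iff.1 (by rw [hχ]; exact one_ne_zero)
  refine ⟨χ, hχ, ?_⟩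
  obtain ⟨ε, hε, hb⟩ := hh.isLocalBranch
  obtain ⟨ε', hε', hb'⟩ := hk.isLocalBranch
  filter_upwards [exists_path_dist_lt hU x.1 (lt_min hε hε'), hh.eventually_ne_zero,
    hk.eventually_ne_zero] with w ⟨hw, δ, hδ⟩ h1 h2
  have e1 := hb ⟨w, hw⟩ δ fun t => (hδ t).trans_le (min_le_left _ _)
  have e2 := hb' ⟨w, hw⟩ δ fun t => (hδ t).trans_le (min_le_right _ _)
  have e3 := hT _ _ _ h1 e1
  have e4 := deck_extend T⁻¹ x δ
  have e5 : toSphere (χ * h₁ w) (h₂ w) = toSphere (k₁ w) (k₂ w) :=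
    e3.symm.trans ((congrArg g e4.symm).trans e2)
  exact ((toSphere_eq_toSphere_iff (h1.imp_left (mul_ne_zero hχ0)) h2).1 e5).symm

end Conj

theorem hasFDerivAt_log_norm {h : ℂ → ℂ} {z : ℂ} (hd : DifferentiableAt ℂ h z) (h0 : h z ≠ 0) :
    HasFDerivAt (fun w => Real.log ‖h w‖) (reForm (deriv h z / h z)) z := by
  have h1 : HasDerivAt (fun w => Complex.log (h w / h z)) (deriv h z / h z) z := by
    have := (hd.hasDerivAt.div_const (h z)).clog (by
      rw [div_self h0]; exact Complex.one_mem_slitPlane)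
    simpa [div_self h0] using this
  have h2 := (Complex.reCLM.hasFDerivAt (x := Complex.log (h z / h z))).comp z
    (h1.hasFDerivAt.restrictScalars ℝ)
  have h3 := h2.add_const (Real.log ‖h z‖)
  have h4 : HasFDerivAt (fun w => Real.log ‖h w‖) _ z := h3.congr_of_eventuallyEq (by
    filter_upwards [hd.continuousAt.eventually_ne h0] with w hw
    simp only [Function.comp_apply, Complex.reCLM_apply, Complex.log_re, norm_div]
    rw [Real.log_div (norm_ne_zero_iff.2 hw) (norm_ne_zero_iff.2 h0)]
    ring)
  refine h4.congr_fderiv ?_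
  refine ContinuousLinearMap.ext fun v => ?_
  change (v • (deriv h z / h z)).re = (deriv h z / h z * v).re
  rw [smul_eq_mul, mul_comm]

section Extract

variable {U : Set ℂ} {z₀ : U} {g : UniversalCover U z₀ → OnePoint ℂ} {lam : ℂ → ℝ}

/-- If the monodromy consists of rotations, then `g / g'` and `log |g|` are single valued. -/
theorem exists_isReciprocalLogDeriv (hU : IsOpen U) (hconn : IsPathConnected U)
    (hlam : ∀ z ∈ U, 0 < lam z) (hg : IsDevelopingMap lam g) (hrot : HasRotationMonodromy g) :
    ∃ (q : ℂ → ℂ) (u : ℂ → ℝ), IsReciprocalLogDeriv U lam q u ∧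
      ∀ (x : UniversalCover U z₀) (h₁ h₂ : ℂ → ℂ), IsHomBranch g x h₁ h₂ →
        q x.1 * wronskian h₁ h₂ x.1 = h₁ x.1 * h₂ x.1 := by
  have hpt : ∀ z : U, ∃ x : UniversalCover U z₀, x.1 = z := fun z => by
    have : PathConnectedSpace U := isPathConnected_iff_pathConnectedSpace.1 hconn
    exact ⟨⟨z, Path.Homotopic.Quotient.mk (PathConnectedSpace.somePath z₀ z)⟩, rfl⟩
  choose X hX using hpt
  have hbr := (isDevelopingMap_iff).1 hg
  choose H₁ H₂ hH _ using hbr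
  classical
  -- the values of `g / g'` and `log |g|` computed on one sheet over each point
  set q : ℂ → ℂ := fun z => if hz : z ∈ U then
    H₁ (X ⟨z, hz⟩) z * H₂ (X ⟨z, hz⟩) z / wronskian (H₁ (X ⟨z, hz⟩)) (H₂ (X ⟨z, hz⟩)) z else 0
    with hq
  set u : ℂ → ℝ := fun z => if hz : z ∈ U then
    Real.log ‖H₁ (X ⟨z, hz⟩) z‖ - Real.log ‖H₂ (X ⟨z, hz⟩) z‖ else 0 with hu
  have key : ∀ (y : UniversalCover U z₀) (k₁ k₂ : ℂ → ℂ), IsHomBranch g y k₁ k₂ →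
      q y.1 = k₁ y.1 * k₂ y.1 / wronskian k₁ k₂ y.1 ∧
      (q y.1 ≠ 0 → u y.1 = Real.log ‖k₁ y.1‖ - Real.log ‖k₂ y.1‖) := by
    intro y k₁ k₂ hk
    have hx := hX y.1
    have hh := hH (X y.1)
    obtain ⟨χ, hχ, hrel⟩ := hrot.exists_mul_eq hU hx hh hk
    have hχ0 : χ ≠ 0 := norm_ne_zero_iff.1 (by rw [hχ]; exact one_ne_zero)
    obtain ⟨l, hl, e1, e2, e3⟩ := exists_wronskian_eq hh.fst.differentiableAt
      hh.snd.differentiableAt (by rw [hx]; exact hk.fst.differentiableAt)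
      (by rw [hx]; exact hk.snd.differentiableAt) hh.ne_zero (by rw [hx]; exact hk.ne_zero)
      hχ0 hrel
    rw [hx] at e1 e2 e3
    have hqv : q y.1 = k₁ y.1 * k₂ y.1 / wronskian k₁ k₂ y.1 := by
      simp only [hq, y.1.2, dif_pos, Subtype.coe_eta]
      rw [e1, e2, e3]
      field_simp
    refine ⟨hqv, fun hq0 => ?_⟩
    rw [hqv] at hq0
    have hk12 : k₁ y.1 ≠ 0 ∧ k₂ y.1 ≠ 0 := by
      constructor <;> intro h <;> simp [h] at hq0
    rw [e1, e2] at hk12 ⊢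
    have n1 : ‖H₁ (X y.1) y.1‖ ≠ 0 := norm_ne_zero_iff.2 (right_ne_zero_of_mul hk12.1)
    have n2 : ‖H₂ (X y.1) y.1‖ ≠ 0 := norm_ne_zero_iff.2 (right_ne_zero_of_mul hk12.2)
    have nl : ‖l‖ ≠ 0 := norm_ne_zero_iff.2 hl
    simp only [hu, y.1.2, dif_pos, Subtype.coe_eta]
    rw [norm_mul, norm_mul, norm_mul, hχ, mul_one, Real.log_mul nl n1, Real.log_mul nl n2]
    ring
  have hW : ∀ (y : UniversalCover U z₀) (k₁ k₂ : ℂ → ℂ), IsHomBranch g y k₁ k₂ →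
      wronskian k₁ k₂ y.1 ≠ 0 := fun y k₁ k₂ hk => hk.wronskian_ne_zero hU hg (hlam _ y.1.2)
  refine ⟨q, u, ?_, fun y k₁ k₂ hk => by
    rw [(key y k₁ k₂ hk).1, div_mul_cancel₀ _ (hW y k₁ k₂ hk)]⟩
  -- near a point of `U`, both functions are computed by one branch
  have hloc : ∀ z ∈ U, ∃ (y : UniversalCover U z₀) (h₁ h₂ : ℂ → ℂ), (y.1 : ℂ) = z ∧
      IsHomBranch g y h₁ h₂ ∧
      (q =ᶠ[𝓝 z] fun w => h₁ w * h₂ w / wronskian h₁ h₂ w) ∧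
      (q z ≠ 0 → u =ᶠ[𝓝 z] fun w => Real.log ‖h₁ w‖ - Real.log ‖h₂ w‖) := by
    intro z hz
    have hx : ((X ⟨z, hz⟩).1 : ℂ) = z := congrArg Subtype.val (hX ⟨z, hz⟩)
    have hh := hH (X ⟨z, hz⟩)
    set x := X ⟨z, hz⟩
    have hev := hh.eventually_extend hU
    have hqe : q =ᶠ[𝓝 z] fun w => H₁ x w * H₂ x w / wronskian (H₁ x) (H₂ x) w := by
      rw [← hx]
      filter_upwards [hev] with w ⟨y, hy, hyb⟩
      have := (key y _ _ hyb).1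
      rwa [hy] at this
    refine ⟨x, H₁ x, H₂ x, hx, hh, hqe, fun hq0 => ?_⟩
    have hqc : ∀ᶠ w in 𝓝 z, H₁ x w * H₂ x w / wronskian (H₁ x) (H₂ x) w ≠ 0 := by
      have ha : AnalyticAt ℂ (fun w => H₁ x w * H₂ x w / wronskian (H₁ x) (H₂ x) w) z := by
        have h1 := hh.fst
        have h2 := hh.snd
        have h3 := hW x _ _ hh
        rw [hx] at h1 h2 h3
        exact (h1.mul h2).div (analyticAt_wronskian h1 h2) h3
      refine ha.continuousAt.eventually_ne ?_
      rwa [hqe.self_of_nhds] at hq0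
    rw [← hx] at hqc hqe ⊢
    filter_upwards [hev, hqc, hqe] with w ⟨y, hy, hyb⟩ h1 h2
    have := (key y _ _ hyb).2
    rw [hy] at this
    exact this (by rw [h2]; exact h1)
  constructor
  · intro z hz
    obtain ⟨y, h₁, h₂, rfl, hb, hqe, -⟩ := hloc z hz
    exact ((hb.fst.mul hb.snd).div (analyticAt_wronskian hb.fst hb.snd)
      (hW y _ _ hb)).congr hqe.symm
  · intro z hz hqz
    obtain ⟨y, h₁, h₂, rfl, hb, hqe, -⟩ := hloc z hz
    have hWy := hW y _ _ hb
    rw [hqe.self_of_nhds, div_eq_zero_iff, or_iff_left hWy] at hqz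
    have hd := ((hb.fst.differentiableAt.hasDerivAt.fun_mul hb.snd.differentiableAt.hasDerivAt).fun_div
      (analyticAt_wronskian hb.fst hb.snd).differentiableAt.hasDerivAt hWy).deriv
    rw [hqe.deriv_eq, hd, hqz, zero_mul, sub_zero]
    have h1 : (deriv h₁ y.1 * h₂ y.1 + h₁ y.1 * deriv h₂ y.1) * wronskian h₁ h₂ y.1
        / wronskian h₁ h₂ y.1 ^ 2 =
        (deriv h₁ y.1 * h₂ y.1 + h₁ y.1 * deriv h₂ y.1) / wronskian h₁ h₂ y.1 := by
      field_simp
    rw [h1, div_eq_iff hWy, div_eq_iff hWy]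
    rcases mul_eq_zero.1 hqz with h0 | h0
    · left; unfold wronskian; rw [h0]; ring
    · right; unfold wronskian; rw [h0]; ring
  · intro z hz hqz
    obtain ⟨y, h₁, h₂, rfl, hb, hqe, hue⟩ := hloc z hz
    have hWy := hW y _ _ hb
    have hq0 := hqz
    rw [hqe.self_of_nhds, div_ne_zero_iff, mul_ne_zero_iff] at hq0
    have hd := (hasFDerivAt_log_norm hb.fst.differentiableAt hq0.1.1).sub
      (hasFDerivAt_log_norm hb.snd.differentiableAt hq0.1.2)
    refine (hd.congr_of_eventuallyEq (hue hqz)).congr_fderiv ?_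
    refine ContinuousLinearMap.ext fun v => ?_
    simp only [sub_apply, reForm_apply]
    rw [← Complex.sub_re, ← sub_mul, hqe.self_of_nhds, inv_div,
      div_sub_div _ _ hq0.1.1 hq0.1.2]
    rfl
  · intro z hz hqz
    obtain ⟨y, h₁, h₂, rfl, hb, hqe, hue⟩ := hloc z hz
    have hq0 := hqz
    rw [hqe.self_of_nhds, div_ne_zero_iff, mul_ne_zero_iff] at hq0
    have n1 : 0 < ‖h₁ y.1‖ := norm_pos_iff.2 hq0.1.1
    have n2 : 0 < ‖h₂ y.1‖ := norm_pos_iff.2 hq0.1.2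
    rw [← hb.metric_eq hU hg, (hue hqz).self_of_nhds, hqe.self_of_nhds, Real.cosh_eq, neg_sub,
      Real.exp_sub, Real.exp_sub, Real.exp_log n1, Real.exp_log n2, norm_inv, norm_div, norm_mul]
    have : ‖wronskian h₁ h₂ y.1‖ ≠ 0 := norm_ne_zero_iff.2 hq0.2
    field_simp
    norm_num

end Extract

/-! ### Matching a developing map with a power product times a rational function -/

/-- Numerator and denominator, without common zeros, of the rational function
`∏ (z - a) ^ k a`, characterized by its logarithmic derivative. -/
theorem exists_polynomial_logDeriv_eq (k : ℂ → ℤ) (T : Finset ℂ) : ∃ A B : Polynomial ℂ,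
    (∀ z, A.eval z ≠ 0 ∨ B.eval z ≠ 0) ∧ ∀ z ∉ T, A.eval z ≠ 0 ∧ B.eval z ≠ 0 ∧
      A.derivative.eval z * B.eval z - A.eval z * B.derivative.eval z
        = (∑ a ∈ T, (k a : ℂ) / (z - a)) * (A.eval z * B.eval z) := by
  classical
  induction T using Finset.induction_on with
  | empty => exact ⟨1, 1, by simp, by simp⟩
  | insert a T ha ih =>
    obtain ⟨A, B, h0, hT⟩ := ih
    set i := (k a).toNat with hi
    set j := (-k a).toNat with hj
    have hij : (k a : ℂ) = i - j := by
      have : k a = (i : ℤ) - j := by omega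
      rw [this]; push_cast; rfl
    have hder : ∀ (l : ℕ) (z : ℂ), z ≠ a →
        (Polynomial.derivative ((Polynomial.X - Polynomial.C a) ^ l)).eval z
          = l * (z - a) ^ l / (z - a) := by
      intro l z hz
      have hz := sub_ne_zero.2 hz
      cases l with
      | zero => simp
      | succ l =>
        simp only [Polynomial.derivative_X_sub_C_pow, Polynomial.eval_mul, Polynomial.eval_pow,
          Polynomial.eval_sub, Polynomial.eval_X, Polynomial.eval_C,
          Nat.add_sub_cancel]
        rw [pow_succ]
        field_simp
    refine ⟨A * (Polynomial.X - Polynomial.C a) ^ i, B * (Polynomial.X - Polynomial.C a) ^ j,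
      fun z => ?_, fun z hz => ?_⟩
    · simp only [Polynomial.eval_mul, Polynomial.eval_pow, Polynomial.eval_sub, Polynomial.eval_X,
        Polynomial.eval_C]
      by_cases hza : z = a
      · subst hza
        rcases (show i = 0 ∨ j = 0 by omega) with h | h
        · left; simpa [h] using (hT z ha).1
        · right; simpa [h] using (hT z ha).2.1
      · have hz := sub_ne_zero.2 hza
        exact (h0 z).imp (fun h => mul_ne_zero h (pow_ne_zero _ hz))
          (fun h => mul_ne_zero h (pow_ne_zero _ hz))
    · rw [Finset.mem_insert, not_or] at hz
      obtain ⟨h1, h2, h3⟩ := hT z hz.2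
      have hza := sub_ne_zero.2 hz.1
      rw [Finset.sum_insert ha, hij]
      simp only [Polynomial.derivative_mul, Polynomial.eval_add, Polynomial.eval_mul,
        hder _ z hz.1, Polynomial.eval_pow, Polynomial.eval_sub, Polynomial.eval_X,
        Polynomial.eval_C]
      refine ⟨mul_ne_zero h1 (pow_ne_zero _ hza), mul_ne_zero h2 (pow_ne_zero _ hza), ?_⟩
      field_simp
      linear_combination (z - a) * h3

/-- The value of `c A / B` can be computed from any representation without common zeros, not only
from the reduced fraction. -/
theorem mulRatFuncValue_div {A B : Polynomial ℂ} {c z : ℂ} (hB : B ≠ 0)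
    (hz : A.eval z ≠ 0 ∨ B.eval z ≠ 0) :
    mulRatFuncValue c (algebraMap (Polynomial ℂ) (RatFunc ℂ) A / algebraMap _ _ B) z
      = toSphere (c * A.eval z) (B.eval z) := by
  set r : RatFunc ℂ := algebraMap (Polynomial ℂ) (RatFunc ℂ) A / algebraMap _ _ B with hr
  have hB' : algebraMap (Polynomial ℂ) (RatFunc ℂ) B ≠ 0 :=
    (map_ne_zero_iff _ (RatFunc.algebraMap_injective ℂ)).2 hB
  have hd' : algebraMap (Polynomial ℂ) (RatFunc ℂ) r.denom ≠ 0 :=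
    (map_ne_zero_iff _ (RatFunc.algebraMap_injective ℂ)).2 r.denom_ne_zero
  have h1 : r.num * B = A * r.denom := by
    apply RatFunc.algebraMap_injective ℂ
    rw [map_mul, map_mul, ← div_eq_div_iff hd' hB', RatFunc.num_div_denom]
  have h2 : r.num.eval z * B.eval z = A.eval z * r.denom.eval z := by
    rw [← Polynomial.eval_mul, h1, Polynomial.eval_mul]
  unfold mulRatFuncValue
  by_cases hd : r.denom.eval z = 0
  · rw [if_pos hd]
    have hn : r.num.eval z ≠ 0 := by
      intro hn
      obtain ⟨s, t, hst⟩ := r.isCoprime_num_denom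
      have := congrArg (Polynomial.eval z) hst
      simp [hn, hd] at this
    rw [hd, mul_zero] at h2
    have hBz : B.eval z = 0 := (mul_eq_zero.1 h2).resolve_left hn
    simp [toSphere, hBz]
  · rw [if_neg hd]
    have hBz : B.eval z ≠ 0 := by
      intro hBz
      rw [hBz, mul_zero] at h2
      exact hz.elim (fun h => h ((mul_eq_zero.1 h2.symm).resolve_right hd)) (fun h => h hBz)
    have h3 : r.eval (RingHom.id ℂ) z = A.eval z / B.eval z := by
      unfold RatFunc.eval
      simp only [Polynomial.eval₂_id]
      rw [div_eq_div_iff hd hBz, h2]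
    simp only [toSphere, hBz, if_false]
    rw [h3, mul_div_assoc]

/-- Two analytic functions whose Wronskian vanishes are proportional near the point. -/
theorem exists_eventuallyEq_const_mul {φ ψ : ℂ → ℂ} {a : ℂ} (hφ : AnalyticAt ℂ φ a)
    (hψ : AnalyticAt ℂ ψ a) (hne : ∀ᶠ z in 𝓝[≠] a, ψ z ≠ 0)
    (hW : ∀ᶠ z in 𝓝[≠] a, deriv φ z * ψ z - φ z * deriv ψ z = 0) :
    ∃ C : ℂ, ∀ᶠ z in 𝓝 a, φ z = C * ψ z := by
  rw [eventually_nhdsWithin_iff] at hne hW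
  obtain ⟨R, hR, hball⟩ := Metric.eventually_nhds_iff_ball.1
    ((hφ.eventually_analyticAt.and hψ.eventually_analyticAt).and (hne.and hW))
  -- the quotient is constant on a disk that avoids `a`; the identity theorem does the rest
  set b : ℂ := a + (R / 2 : ℝ) with hb
  have hab : dist b a = R / 2 := by
    rw [hb, dist_eq_norm, add_sub_cancel_left, Complex.norm_real,
      Real.norm_of_nonneg (half_pos hR).le]
  have hsub : ∀ z ∈ Metric.ball b (R / 2), z ∈ Metric.ball a R ∧ z ≠ a := by
    intro z hz
    rw [Metric.mem_ball] at hz ⊢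
    constructor
    · linarith [dist_triangle z b a]
    · rintro rfl
      rw [dist_comm, hab] at hz
      exact lt_irrefl _ hz
  have hd : ∀ z ∈ Metric.ball b (R / 2), HasDerivAt (fun z => φ z / ψ z) 0 z := by
    intro z hz
    obtain ⟨h1, h2⟩ := hsub z hz
    obtain ⟨⟨h3, h4⟩, h5, h6⟩ := hball z h1
    have := h3.differentiableAt.hasDerivAt.fun_div h4.differentiableAt.hasDerivAt (h5 h2)
    rwa [h6 h2, zero_div] at this
  obtain ⟨C, hC⟩ := Metric.isOpen_ball.exists_is_const_of_deriv_eq_zero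
    (convex_ball b (R / 2)).isPreconnected
    (fun z hz => (hd z hz).differentiableAt.differentiableWithinAt) (fun z hz => (hd z hz).deriv)
  refine ⟨C, ?_⟩
  have heq : φ =ᶠ[𝓝 b] fun z => C * ψ z := by
    filter_upwards [Metric.ball_mem_nhds b (half_pos hR)] with z hz
    obtain ⟨h1, h2⟩ := hsub z hz
    rw [← hC z hz, div_mul_cancel₀ _ ((hball z h1).2.1 h2)]
  have := AnalyticOnNhd.eqOn_of_preconnected_of_eventuallyEq (U := Metric.ball a R)
    (fun z hz => (hball z hz).1.1) (fun z hz => analyticAt_const.mul (hball z hz).1.2)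
    (convex_ball a R).isPreconnected (hsub b (Metric.mem_ball_self (half_pos hR))).1 heq
  filter_upwards [Metric.ball_mem_nhds a hR] with z hz using this hz

section Matching

/-- The logarithmic derivative `∑ τ j / (z - p j)` of the power product. -/
def powerLogDeriv {m : ℕ} (p : Fin m → ℂ) (τ : Fin m → ℝ) (z : ℂ) : ℂ :=
  ∑ j, (τ j : ℂ) / (z - p j)

/-- `P` is, near `a`, the branch of the multivalued power product with value `e ≠ 0` at `a`. -/
structure IsPowerBranch {m : ℕ} (p : Fin m → ℂ) (τ : Fin m → ℝ) (a e : ℂ) (P : ℂ → ℂ) : Prop where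
  analyticAt : AnalyticAt ℂ P a
  value : P a = e
  deriv_eq : ∀ᶠ z in 𝓝 a, deriv P z = powerLogDeriv p τ z * P z
  ne_zero : e ≠ 0

variable {m : ℕ} {p : Fin m → ℂ} {τ : Fin m → ℝ} {a e : ℂ} {P P' : ℂ → ℂ}

/-- A branch is given by principal logarithms of `(z - p j) / (a - p j)`, which is close to `1`. -/
theorem exists_isPowerBranch (ha : ∀ j, a ≠ p j) (he : e ≠ 0) :
    ∃ P, IsPowerBranch p τ a e P := by
  have hap : ∀ j, a - p j ≠ 0 := fun j => sub_ne_zero.2 (ha j)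
  have hslit : ∀ᶠ z in 𝓝 a, ∀ j, (z - p j) / (a - p j) ∈ Complex.slitPlane := by
    rw [eventually_all]
    intro j
    have hc : ContinuousAt (fun z => (z - p j) / (a - p j)) a :=
      (continuousAt_id.sub continuousAt_const).div_const _
    refine hc.eventually_mem (Complex.isOpen_slitPlane.mem_nhds ?_)
    rw [div_self (hap j)]
    exact Complex.one_mem_slitPlane
  have hder : ∀ z, (∀ j, (z - p j) / (a - p j) ∈ Complex.slitPlane) →
      HasDerivAt (fun z => e * Complex.exp (∑ j, (τ j : ℂ) * Complex.log ((z - p j) / (a - p j))))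
        (powerLogDeriv p τ z *
          (e * Complex.exp (∑ j, (τ j : ℂ) * Complex.log ((z - p j) / (a - p j))))) z := by
    intro z hz
    have h1 : HasDerivAt (fun z => ∑ j, (τ j : ℂ) * Complex.log ((z - p j) / (a - p j)))
        (powerLogDeriv p τ z) z := by
      refine HasDerivAt.fun_sum fun j _ => ?_
      have h2 := ((((hasDerivAt_id z).sub_const (p j)).div_const (a - p j)).clog
        (hz j)).const_mul (τ j : ℂ)
      refine h2.congr_deriv ?_
      have h3 := Complex.slitPlane_ne_zero (hz j)
      have h4 : z - p j ≠ 0 := fun h => h3 (by rw [h, zero_div])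
      have h5 := hap j
      simp only [id]
      field_simp
    refine (h1.cexp.const_mul e).congr_deriv ?_
    ring
  refine ⟨_, ?_, ?_, hslit.mono fun z hz => (hder z hz).deriv, he⟩
  · rw [Complex.analyticAt_iff_eventually_differentiableAt]
    exact hslit.mono fun z hz => (hder z hz).differentiableAt
  · simp [div_self (hap _)]

theorem IsPowerBranch.eventually_ne_zero (h : IsPowerBranch p τ a e P) :
    ∀ᶠ z in 𝓝 a, P z ≠ 0 :=
  h.analyticAt.continuousAt.eventually_ne (by rw [h.value]; exact h.ne_zero)

theorem IsPowerBranch.eventuallyEq (h : IsPowerBranch p τ a e P) (h' : IsPowerBranch p τ a e P') :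
    P =ᶠ[𝓝 a] P' := by
  obtain ⟨C, hC⟩ := exists_eventuallyEq_const_mul h.analyticAt h'.analyticAt
    (h'.eventually_ne_zero.filter_mono nhdsWithin_le_nhds) (by
      filter_upwards [h.deriv_eq.filter_mono nhdsWithin_le_nhds,
        h'.deriv_eq.filter_mono nhdsWithin_le_nhds] with z h1 h2
      rw [h1, h2]; ring)
  have := hC.self_of_nhds
  rw [h.value, h'.value] at this
  have hC1 : C = 1 := (mul_eq_right₀ h.ne_zero).1 this.symm
  filter_upwards [hC] with z hz
  rw [hz, hC1, one_mul]

theorem IsPowerBranch.eventually (h : IsPowerBranch p τ a e P) :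
    ∀ᶠ z in 𝓝 a, IsPowerBranch p τ z (P z) P := by
  filter_upwards [h.analyticAt.eventually_analyticAt, h.deriv_eq.eventually_nhds,
    h.eventually_ne_zero] with z h1 h2 h3
  exact ⟨h1, rfl, h2, h3⟩

variable {U : Set ℂ} {z₀ : U} {g : UniversalCover U z₀ → OnePoint ℂ}

/-- Near the point `x` of the universal cover, `g` is `C` times `A / B` times the branch of the
power product which has the value `e` at `x`. -/
def IsMatched (g : UniversalCover U z₀ → OnePoint ℂ) (p : Fin m → ℂ) (τ : Fin m → ℝ)
    (A B : Polynomial ℂ) (x : UniversalCover U z₀) (e C : ℂ) : Prop :=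
  ∃ h₁ h₂ P : ℂ → ℂ, IsHomBranch g x h₁ h₂ ∧ IsPowerBranch p τ x.1 e P ∧
    ∀ᶠ z in 𝓝 (x.1 : ℂ), h₁ z * B.eval z = C * (P z * A.eval z * h₂ z)

variable {A B : Polynomial ℂ} {x : UniversalCover U z₀} {q : ℂ → ℂ} {S : Finset ℂ} {κ : ℂ → ℂ}

theorem IsMatched.apply_eq {C : ℂ} (h : IsMatched g p τ A B x e C) (hC : C ≠ 0)
    (hAB : A.eval (x.1 : ℂ) ≠ 0 ∨ B.eval (x.1 : ℂ) ≠ 0) :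
    g x = toSphere (e * (C * A.eval (x.1 : ℂ))) (B.eval (x.1 : ℂ)) := by
  obtain ⟨h₁, h₂, P, hb, hP, hm⟩ := h
  rw [hb.isLocalBranch.apply_self, toSphere_eq_toSphere_iff hb.ne_zero
    (hAB.imp_left fun h => mul_ne_zero hP.ne_zero (mul_ne_zero hC h))]
  rw [hm.self_of_nhds, hP.value]
  ring

/-- The hypotheses under which `g / g'` determines `g` up to a constant: away from a finite set,
`g' / g` is the logarithmic derivative of the power product times `A / B`. -/
structure LogDerivData (g : UniversalCover U z₀ → OnePoint ℂ) (p : Fin m → ℂ) (τ : Fin m → ℝ)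
    (A B : Polynomial ℂ) (S : Finset ℂ) (q κ : ℂ → ℂ) : Prop where
  isOpen : IsOpen U
  notMem : ∀ j, p j ∉ U
  exists_branch : ∀ x : UniversalCover U z₀, ∃ h₁ h₂, IsHomBranch g x h₁ h₂
  wronskian_ne_zero : ∀ (x : UniversalCover U z₀) (h₁ h₂ : ℂ → ℂ), IsHomBranch g x h₁ h₂ →
    wronskian h₁ h₂ x.1 ≠ 0
  mul_wronskian : ∀ (x : UniversalCover U z₀) (h₁ h₂ : ℂ → ℂ), IsHomBranch g x h₁ h₂ →
    q x.1 * wronskian h₁ h₂ x.1 = h₁ x.1 * h₂ x.1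
  logDeriv_eq : ∀ z ∉ S, q z ≠ 0 ∧ (q z)⁻¹ = powerLogDeriv p τ z + κ z
  polynomial : ∀ z ∉ S, A.eval z ≠ 0 ∧ B.eval z ≠ 0 ∧
      A.derivative.eval z * B.eval z - A.eval z * B.derivative.eval z
        = κ z * (A.eval z * B.eval z)

theorem eventually_notMem_finset (S : Finset ℂ) (a : ℂ) : ∀ᶠ z in 𝓝[≠] a, z ∉ S := by
  have h : ((S : Set ℂ) \ {a})ᶜ ∈ 𝓝 a :=
    (S.finite_toSet.subset Set.sdiff_subset).isClosed.isOpen_compl.mem_nhds (by simp)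
  filter_upwards [mem_nhdsWithin_of_mem_nhds h, self_mem_nhdsWithin] with z hz hza hzp
  exact hz ⟨hzp, hza⟩

theorem LogDerivData.eventually_branch (hD : LogDerivData g p τ A B S q κ) {h₁ h₂ : ℂ → ℂ}
    (hb : IsHomBranch g x h₁ h₂) : ∀ᶠ z in 𝓝[≠] (x.1 : ℂ), z ∉ S ∧ h₁ z ≠ 0 ∧ h₂ z ≠ 0 ∧
      wronskian h₁ h₂ z = h₁ z * h₂ z * (powerLogDeriv p τ z + κ z) := by
  filter_upwards [(hb.eventually_extend hD.isOpen).filter_mono nhdsWithin_le_nhds,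
    eventually_notMem_finset S x.1] with z ⟨y, hy, hyb⟩ hz
  have h1 := hD.mul_wronskian y _ _ hyb
  have h2 := hD.wronskian_ne_zero y _ _ hyb
  rw [hy] at h1 h2
  obtain ⟨h3, h4⟩ := hD.logDeriv_eq z hz
  have h5 := mul_ne_zero h3 h2
  rw [h1] at h5
  refine ⟨hz, left_ne_zero_of_mul h5, right_ne_zero_of_mul h5, ?_⟩
  rw [← h4, ← h1]
  field_simp

/-- Every branch `[h₁ : h₂]` of `g` agrees up to a constant with `[P A : B]`: the Wronskian of
`h₁ B` and `P A h₂` vanishes since `[h₁ : h₂]` and `[P A : B]` have the same logarithmic derivative. -/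
theorem LogDerivData.exists_isMatched (hD : LogDerivData g p τ A B S q κ)
    (x : UniversalCover U z₀) (he : e ≠ 0) : ∃ C, C ≠ 0 ∧ IsMatched g p τ A B x e C := by
  obtain ⟨h₁, h₂, hb⟩ := hD.exists_branch x
  obtain ⟨P, hP⟩ := exists_isPowerBranch (p := p) (τ := τ) (a := (x.1 : ℂ)) (e := e)
    (fun j h => hD.notMem j (h ▸ x.1.2)) he
  have hA : AnalyticAt ℂ (fun z => A.eval z) (x.1 : ℂ) := A.differentiable.analyticAt _
  have hB : AnalyticAt ℂ (fun z => B.eval z) (x.1 : ℂ) := B.differentiable.analyticAt _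
  have hev := hD.eventually_branch hb
  have hPne := hP.eventually_ne_zero.filter_mono (nhdsWithin_le_nhds (s := {(x.1 : ℂ)}ᶜ))
  obtain ⟨C, hC⟩ := exists_eventuallyEq_const_mul (φ := fun z => h₁ z * B.eval z)
    (ψ := fun z => P z * A.eval z * h₂ z) (hb.fst.mul hB) ((hP.analyticAt.mul hA).mul hb.snd)
    (by
      filter_upwards [hev, hPne] with z h1 h2
      exact mul_ne_zero (mul_ne_zero h2 (hD.polynomial z h1.1).1) h1.2.2.1)
    (by
      filter_upwards [hev, hP.deriv_eq.filter_mono nhdsWithin_le_nhds,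
        hP.analyticAt.eventually_analyticAt.filter_mono nhdsWithin_le_nhds,
        hb.fst.eventually_analyticAt.filter_mono nhdsWithin_le_nhds,
        hb.snd.eventually_analyticAt.filter_mono nhdsWithin_le_nhds] with z h1 h2 h3 h4 h5
      have d1 := (h4.differentiableAt.hasDerivAt.fun_mul (B.hasDerivAt z)).deriv
      have d2 := ((h3.differentiableAt.hasDerivAt.fun_mul (A.hasDerivAt z)).fun_mul
        h5.differentiableAt.hasDerivAt).deriv
      rw [d1, d2, h2]
      have h6 := h1.2.2.2
      have h7 := (hD.polynomial z h1.1).2.2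
      unfold wronskian at h6
      linear_combination P z * A.eval z * B.eval z * h6 - P z * h₁ z * h₂ z * h7)
  refine ⟨C, ?_, h₁, h₂, P, hb, hP, hC⟩
  rintro rfl
  obtain ⟨z, h1, h2⟩ := (hev.and (hC.filter_mono nhdsWithin_le_nhds)).exists
  rw [zero_mul] at h2
  exact mul_ne_zero h1.2.1 (hD.polynomial z h1.1).2.1 h2

theorem LogDerivData.isMatched_unique (hD : LogDerivData g p τ A B S q κ) {C C' : ℂ}
    (h : IsMatched g p τ A B x e C) (h' : IsMatched g p τ A B x e C') : C = C' := by
  obtain ⟨h₁, h₂, P, hb, hP, hm⟩ := h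
  obtain ⟨k₁, k₂, P', kb, kP, km⟩ := h'
  obtain ⟨z, h1, h2, h3, h4, h5, h6, h7⟩ := ((hD.eventually_branch hb).and
    ((hD.eventually_branch kb).and ((hm.and (km.and ((hP.eventuallyEq kP).and
      ((hb.isLocalBranch.eventuallyEq hD.isOpen kb.isLocalBranch).and
        hP.eventually_ne_zero)))).filter_mono nhdsWithin_le_nhds))).exists
  have h8 := (toSphere_eq_toSphere_iff (Or.inl h1.2.1) (Or.inl h2.2.1)).1 h6
  rw [← h5] at h4
  have h9 : P z * A.eval z * h₂ z * k₂ z ≠ 0 :=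
    mul_ne_zero (mul_ne_zero (mul_ne_zero h7 (hD.polynomial z h1.1).1) h1.2.2.1) h2.2.2.1
  refine mul_right_cancel₀ h9 ?_
  linear_combination -k₂ z * h3 + h₂ z * h4 + B.eval z * h8

/-- Matching with a constant `C` is propagated along short paths. -/
theorem IsMatched.exists_extend {C : ℂ} (h : IsMatched g p τ A B x e C) :
    ∃ P, IsPowerBranch p τ x.1 e P ∧ ∃ ε > 0, ∀ (w : U) (δ : Path x.1 w),
      (∀ t, dist (δ t) x.1 < ε) → IsMatched g p τ A B (x.extend δ) (P w) C := by
  obtain ⟨h₁, h₂, P, hb, hP, hm⟩ := h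
  refine ⟨P, hP, ?_⟩
  obtain ⟨ε, hε, hF⟩ := hb.isLocalBranch
  obtain ⟨ε', hε', hev⟩ := Metric.eventually_nhds_iff.1 (hP.eventually.and
    (hm.eventually_nhds.and (hb.fst.eventually_analyticAt.and (hb.snd.eventually_analyticAt.and
      hb.eventually_ne_zero))))
  refine ⟨min ε ε', lt_min hε hε', fun w δ hδ => ?_⟩
  have hw : dist (w : ℂ) x.1 < ε' := by
    have := hδ 1
    rw [δ.target] at this
    exact this.trans_le (min_le_right _ _)
  obtain ⟨e1, e2, e3, e4, e5⟩ := hev hw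
  exact ⟨h₁, h₂, P, ⟨e3, e4, e5, IsLocalBranch.extend hF fun t => (hδ t).trans_le (min_le_left _ _)⟩,
    e1, e2⟩

end Matching

/-! ### Propagation of the matching constant along paths -/

section Path

variable {X : Type*} [TopologicalSpace X] {x₀ z : X}

/-- The lift of the path `γ` to the universal cover that starts at the base point. -/
def pathLift (γ : Path x₀ z) (t : unitInterval) : UniversalCover X x₀ :=
  ⟨γ t, Path.Homotopic.Quotient.mk ((γ.subpath 0 t).cast γ.source.symm rfl)⟩

theorem pathLift_zero (γ : Path x₀ z) :
    pathLift γ 0 = ⟨x₀, Path.Homotopic.Quotient.refl x₀⟩ := by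
  unfold pathLift
  rw [Path.subpath_self]
  have : ∀ (y : X) (h : x₀ = y), (⟨y, Path.Homotopic.Quotient.mk ((Path.refl y).cast h rfl)⟩ :
      UniversalCover X x₀) = ⟨x₀, Path.Homotopic.Quotient.refl x₀⟩ := by
    rintro y rfl
    rfl
  exact this _ _

theorem pathLift_one (γ : Path x₀ z) :
    pathLift γ 1 = ⟨z, Path.Homotopic.Quotient.mk γ⟩ := by
  unfold pathLift
  rw [Path.subpath_zero_one]
  have : ∀ (y : X) (h : y = z), (⟨y, Path.Homotopic.Quotient.mk (γ.cast rfl h)⟩ :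
      UniversalCover X x₀) = ⟨z, Path.Homotopic.Quotient.mk γ⟩ := by
    rintro y rfl
    rfl
  exact this _ γ.target

theorem extend_pathLift (γ : Path x₀ z) (t₀ t : unitInterval) :
    UniversalCover.extend (pathLift γ t₀) (γ.subpath t₀ t) = pathLift γ t := by
  unfold UniversalCover.extend pathLift
  congr 1
  rw [← Path.Homotopic.Quotient.mk_trans, Path.Homotopic.Quotient.eq]
  have h : Path.Homotopic ((γ.subpath 0 t₀).trans (γ.subpath t₀ t)) (γ.subpath 0 t) :=
    ⟨Path.Homotopy.subpathTransSubpath γ 0 t₀ t⟩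
  exact h.pathCast γ.source.symm rfl

end Path

section Power

variable {U : Set ℂ} {z₀ z : U} {m : ℕ} {p : Fin m → ℂ} {τ : Fin m → ℝ}

/-- The power product along a path solves the differential equation of its local branches. -/
theorem exists_powerProduct_along (hp : ∀ j, p j ∉ U) (γ : Path z₀ z)
    (hγ : ContDiffOn ℝ 1 (pathInPlane γ).extend unitInterval) :
    ∃ E : ℝ → ℂ, E 0 = 1 ∧ E 1 = powerProduct p τ γ ∧ (∀ t, E t ≠ 0) ∧
      ∀ t ∈ unitInterval, HasDerivWithinAt E
        (powerLogDeriv p τ ((pathInPlane γ).extend t) *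
          derivWithin (pathInPlane γ).extend unitInterval t * E t) unitInterval t := by
  set c := (pathInPlane γ).extend with hc
  have hcU : ∀ t, c t ∈ U := fun t => (γ (Set.projIcc 0 1 zero_le_one t)).2
  have hne : ∀ t j, c t - p j ≠ 0 := fun t j h => hp j (sub_eq_zero.1 h ▸ hcU t)
  have hcont : ContinuousOn (derivWithin c unitInterval) unitInterval :=
    hγ.continuousOn_derivWithin (uniqueDiffOn_Icc zero_lt_one) le_rfl
  have hccont : Continuous c := (pathInPlane γ).continuous_extend
  -- the integrand, continued to the real line by constants
  set f : Fin m → ℝ → ℂ := fun j => Set.IccExtend (zero_le_one (α := ℝ))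
    (fun t : unitInterval => (c t - p j)⁻¹ * derivWithin c unitInterval t) with hf
  have hfc : ∀ j, Continuous (f j) := fun j => by
    refine Continuous.Icc_extend' ?_
    exact continuousOn_iff_continuous_domRestrict.1
      ((((hccont.sub continuous_const).inv₀ fun t => hne t j).continuousOn).mul hcont)
  have hfeq : ∀ j, ∀ t ∈ unitInterval, f j t = (c t - p j)⁻¹ * derivWithin c unitInterval t :=
    fun j t ht => by
      rw [hf]
      simp only [Set.IccExtend_of_mem _ _ ht]
  refine ⟨fun t => Complex.exp (∑ j, (τ j : ℂ) * ∫ s in (0 : ℝ)..t, f j s), by simp, ?_,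
    fun t => Complex.exp_ne_zero _, fun t ht => ?_⟩
  · unfold powerProduct
    refine congrArg Complex.exp ?_
    refine Finset.sum_congr rfl fun j _ => ?_
    congr 1
    unfold logIntegral
    rw [curveIntegral_def]
    refine intervalIntegral.integral_congr fun t ht => ?_
    rw [Set.uIcc_of_le zero_le_one] at ht
    rw [hfeq j t ht, curveIntegralFun_def]
    rfl
  · have h1 : ∀ j, HasDerivAt (fun t => ∫ s in (0 : ℝ)..t, f j s) (f j t) t := fun j =>
      ((hfc j).integral_hasStrictDerivAt 0 t).hasDerivAt
    have h2 := (HasDerivAt.fun_sum (u := Finset.univ)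
      fun j _ => (h1 j).const_mul (τ j : ℂ)).cexp
    refine h2.hasDerivWithinAt.congr_deriv ?_
    rw [mul_comm]
    congr 1
    rw [powerLogDeriv, Finset.sum_mul]
    refine Finset.sum_congr rfl fun j _ => ?_
    rw [hfeq j t ht, div_eq_mul_inv, mul_assoc]

theorem pathInPlane_extend_coe (γ : Path z₀ z) (t : unitInterval) :
    (pathInPlane γ).extend t = (γ t : ℂ) := by
  rw [Path.extend_apply _ t.2]
  rfl

/-- The power product along a path is, near each parameter, a branch of the power product
evaluated along the path. -/
theorem eventually_eq_of_isPowerBranch {γ : Path z₀ z}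
    (hγ : ContDiffOn ℝ 1 (pathInPlane γ).extend unitInterval) {E : ℝ → ℂ}
    (hE : ∀ t ∈ unitInterval, HasDerivWithinAt E
        (powerLogDeriv p τ ((pathInPlane γ).extend t) *
          derivWithin (pathInPlane γ).extend unitInterval t * E t) unitInterval t)
    {t₀ : unitInterval} {P : ℂ → ℂ} (hP : IsPowerBranch p τ (γ t₀) (E t₀) P) :
    ∀ᶠ t : unitInterval in 𝓝 t₀, E t = P (γ t) := by
  set c := (pathInPlane γ).extend with hc
  have hc0 : c t₀ = γ t₀ := pathInPlane_extend_coe γ t₀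
  have hccont : Continuous c := (pathInPlane γ).continuous_extend
  have hev : ∀ᶠ s : ℝ in 𝓝 (t₀ : ℝ), AnalyticAt ℂ P (c s) ∧
      deriv P (c s) = powerLogDeriv p τ (c s) * P (c s) ∧ P (c s) ≠ 0 := by
    refine (hccont.tendsto' _ _ hc0).eventually (p := fun w => AnalyticAt ℂ P w ∧
      deriv P w = powerLogDeriv p τ w * P w ∧ P w ≠ 0) ?_
    exact hP.analyticAt.eventually_analyticAt.and (hP.deriv_eq.and hP.eventually_ne_zero)
  obtain ⟨η, hη, hball⟩ := Metric.eventually_nhds_iff_ball.1 hev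
  set s := Metric.ball (t₀ : ℝ) η ∩ unitInterval with hs
  have hconv : Convex ℝ s := (convex_ball _ _).inter (convex_Icc 0 1)
  have hD : ∀ t ∈ s, HasDerivWithinAt (fun t => E t / P (c t)) 0 s t := by
    intro t ht
    obtain ⟨h1, h2, h3⟩ := hball t ht.1
    have h4 : HasDerivWithinAt c (derivWithin c unitInterval t) unitInterval t :=
      ((hγ.differentiableOn one_ne_zero) t ht.2).hasDerivWithinAt
    have h5 := h1.differentiableAt.hasDerivAt.comp_hasDerivWithinAt t h4
    have h6 := (hE t ht.2).fun_div h5 h3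
    refine (h6.mono Set.inter_subset_right).congr_deriv ?_
    rw [Function.comp_apply, h2]
    ring
  filter_upwards [continuous_subtype_val.continuousAt.preimage_mem_nhds
    (Metric.ball_mem_nhds (t₀ : ℝ) hη)] with t ht
  have h0 : (t₀ : ℝ) ∈ s := ⟨Metric.mem_ball_self hη, t₀.2⟩
  have hts : (t : ℝ) ∈ s := ⟨ht, t.2⟩
  have hmvt := hconv.norm_image_sub_le_of_norm_hasDerivWithin_le (C := 0) hD (fun x hx => by simp)
    h0 hts
  rw [zero_mul, norm_le_zero_iff, sub_eq_zero, hc0, hP.value, div_self hP.ne_zero] at hmvt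
  have h3 := (hball t ht).2.2
  rw [div_eq_one_iff_eq h3] at hmvt
  rw [hmvt]
  exact congrArg P (pathInPlane_extend_coe γ t)

theorem eventually_subpath_dist_lt (γ : Path z₀ z) (t₀ : unitInterval) {ε : ℝ} (hε : 0 < ε) :
    ∀ᶠ t in 𝓝 t₀, ∀ s, dist (γ.subpath t₀ t s) (γ t₀) < ε := by
  obtain ⟨η, hη, hball⟩ := Metric.eventually_nhds_iff_ball.1
    (γ.continuous.continuousAt.eventually (Metric.ball_mem_nhds (γ t₀) hε))
  filter_upwards [Metric.ball_mem_nhds t₀ hη] with t ht s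
  have h1 : γ.subpath t₀ t s ∈ γ '' Set.uIcc t₀ t := by
    rw [← Path.range_subpath]
    exact ⟨s, rfl⟩
  obtain ⟨r, hr, hrs⟩ := h1
  rw [← hrs]
  refine hball r ?_
  rw [Metric.mem_ball] at ht ⊢
  refine lt_of_le_of_lt ?_ ht
  have h2 : (r : ℝ) ∈ Set.uIcc (t₀ : ℝ) t := by
    rw [Set.mem_uIcc] at hr ⊢
    exact hr
  have h3 := Set.abs_sub_left_of_mem_uIcc h2
  rw [Subtype.dist_eq, Subtype.dist_eq, Real.dist_eq, Real.dist_eq]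
  exact h3

variable {g : UniversalCover U z₀ → OnePoint ℂ} {A B : Polynomial ℂ} {q κ : ℂ → ℂ} {S : Finset ℂ}

/-- The matching constant does not change along a path: it is locally constant. -/
theorem LogDerivData.isMatched_powerProduct (hD : LogDerivData g p τ A B S q κ) {C : ℂ}
    (hC : IsMatched g p τ A B ⟨z₀, Path.Homotopic.Quotient.refl z₀⟩ 1 C) (γ : Path z₀ z)
    (hγ : ContDiffOn ℝ 1 (pathInPlane γ).extend unitInterval) :
    IsMatched g p τ A B ⟨z, Path.Homotopic.Quotient.mk γ⟩ (powerProduct p τ γ) C := by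
  obtain ⟨E, hE0, hE1, hEne, hE⟩ := exists_powerProduct_along (τ := τ) hD.notMem γ hγ
  have hloc : ∀ (t₀ : unitInterval) (C : ℂ), IsMatched g p τ A B (pathLift γ t₀) (E t₀) C →
      ∀ᶠ t in 𝓝 t₀, IsMatched g p τ A B (pathLift γ t) (E t) C := by
    intro t₀ C h
    obtain ⟨P, hP, ε, hε, hext⟩ := h.exists_extend
    filter_upwards [eventually_eq_of_isPowerBranch hγ hE hP, eventually_subpath_dist_lt γ t₀ hε]
      with t h1 h2
    rw [h1, ← extend_pathLift γ t₀ t]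
    exact hext _ (γ.subpath t₀ t) h2
  set s : Set unitInterval := {t | IsMatched g p τ A B (pathLift γ t) (E t) C} with hs
  have hopen : IsOpen s := isOpen_iff_mem_nhds.2 fun t ht => hloc t C ht
  have hclosed : IsClosed s := by
    refine ⟨isOpen_iff_mem_nhds.2 fun t ht => ?_⟩
    obtain ⟨C', -, hC'⟩ := hD.exists_isMatched (pathLift γ t) (hEne t)
    filter_upwards [hloc t C' hC'] with r hr hrs
    have hCC : C = C' := hD.isMatched_unique hrs hr
    exact ht (by rw [hs, Set.mem_ofPred_eq, hCC]; exact hC')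
  have h0 : (0 : unitInterval) ∈ s := by
    rw [hs, Set.mem_ofPred_eq, pathLift_zero]
    rw [show ((0 : unitInterval) : ℝ) = 0 from rfl, hE0]
    exact hC
  have huniv := IsClopen.eq_univ ⟨hclosed, hopen⟩ ⟨0, h0⟩
  have h1 : (1 : unitInterval) ∈ s := huniv ▸ Set.mem_univ _
  rw [hs, Set.mem_ofPred_eq, pathLift_one] at h1
  rw [show ((1 : unitInterval) : ℝ) = 1 from rfl, hE1] at h1
  exact h1

end Power

end ConicalSpherical

end

theorem propositionB1 (n m : ℕ) (hmn : m ≤ n) (p : Fin n → ℂ) (hp : Function.Injective p)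
    (z₀ : ConicalSpherical.puncturedPlane p)
    (lam : ℂ → ℝ)
    (hlam : ConicalSpherical.IsSphericalMetricOn lam (ConicalSpherical.puncturedPlane p))
    (β : Fin n → ℝ) (βinf : ℝ)
    (hcone : ∀ j, ConicalSpherical.HasConicalSingularityAt lam (p j) (β j))
    (hconeinf : ConicalSpherical.HasConicalSingularityAtInfty lam βinf)
    (hred : ConicalSpherical.IsReducible lam (ConicalSpherical.puncturedPlane p) z₀)
    (hnonint : ∀ j : Fin n, (j : ℕ) < m → β j ∉ Set.range ((↑) : ℤ → ℝ))
    (hint : ∀ j : Fin n, m ≤ (j : ℕ) → β j ∈ Set.range ((↑) : ℤ → ℝ))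
    (hnonintinf : βinf ∉ Set.range ((↑) : ℤ → ℝ)) :
    ∃ (τ : Fin m → ℝ) (r : RatFunc ℂ)
      (g : ConicalSpherical.UniversalCover (ConicalSpherical.puncturedPlane p) z₀ → OnePoint ℂ),
      (∀ j, τ j ∉ Set.range ((↑) : ℤ → ℝ)) ∧
      ConicalSpherical.IsDevelopingMap lam g ∧
      ∀ (z : ConicalSpherical.puncturedPlane p) (γ : Path z₀ z),
        ContDiffOn ℝ 1 (ConicalSpherical.pathInPlane γ).extend unitInterval →
        g ⟨z, Path.Homotopic.Quotient.mk γ⟩ =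
          ConicalSpherical.mulRatFuncValue
            (ConicalSpherical.powerProduct (fun j => p (Fin.castLE hmn j)) τ γ) r z := by
  open ConicalSpherical in
  classical
  have hU := isOpen_puncturedPlane p
  obtain ⟨g, hg, hrot⟩ := hred.exists_rotationMonodromy
  obtain ⟨q, u, hq, hqW⟩ := exists_isReciprocalLogDeriv hU (isPathConnected_puncturedPlane p)
    hlam.pos hg hrot
  obtain ⟨S, e, hpS, hez, hep, hfrac⟩ := hq.exists_partialFractions hlam.pos hcone hconeinf
  -- the residues at the first `m` punctures are the exponents; all others are integers
  set p' : Fin m → ℂ := fun j => p (Fin.castLE hmn j) with hp'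
  set τ : Fin m → ℝ := fun j => e (p' j) with hτ
  have hp'inj : Function.Injective p' := hp.comp (Fin.castLE_injective hmn)
  set R : Finset ℂ := Finset.univ.image p' with hR
  have hRS : R ⊆ S := by
    intro a ha
    obtain ⟨j, -, rfl⟩ := Finset.mem_image.1 ha
    exact hpS _
  set T : Finset ℂ := S \ R with hT
  have hTint : ∀ a ∈ T, ∃ k : ℤ, (k : ℝ) = e a := by
    intro a ha
    obtain ⟨haS, haR⟩ := Finset.mem_sdiff.1 ha
    by_cases hap : a ∈ Set.range p
    · obtain ⟨j, rfl⟩ := hap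
      refine (hep j).2 (hint j (not_lt.1 fun hj => haR ?_))
      exact Finset.mem_image.2 ⟨⟨j, hj⟩, Finset.mem_univ _, rfl⟩
    · exact hez a haS hap
  choose! k hk using hTint
  obtain ⟨A, B, hAB, hABT⟩ := exists_polynomial_logDeriv_eq k T
  have hD : LogDerivData g p' τ A B S q (fun z => ∑ a ∈ T, (k a : ℂ) / (z - a)) :=
    { isOpen := hU
      notMem := fun j h => h ⟨_, rfl⟩
      exists_branch := fun x => by
        obtain ⟨h₁, h₂, h, -⟩ := isDevelopingMap_iff.1 hg x
        exact ⟨h₁, h₂, h⟩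
      wronskian_ne_zero := fun x h₁ h₂ h => h.wronskian_ne_zero hU hg (hlam.pos _ x.1.2)
      mul_wronskian := hqW
      logDeriv_eq := fun z hz => by
        refine ⟨(hfrac z hz).1, ?_⟩
        rw [(hfrac z hz).2, ← Finset.sum_sdiff hRS, add_comm]
        congr 1
        · rw [hR, Finset.sum_image fun i _ j _ h => hp'inj h]
          rfl
        · refine Finset.sum_congr rfl fun a ha => ?_
          rw [← hk a ha, Complex.ofReal_intCast]
      polynomial := fun z hz => hABT z fun h => hz (Finset.mem_sdiff.1 h).1 }
  obtain ⟨C, hC0, hC⟩ := hD.exists_isMatched ⟨z₀, Path.Homotopic.Quotient.refl z₀⟩ one_ne_zero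
  have hB0 : B ≠ 0 := by
    rintro rfl
    obtain ⟨z, hz⟩ := (eventually_notMem_finset T 0).exists
    exact (hABT z hz).2.1 (by simp)
  refine ⟨τ, algebraMap (Polynomial ℂ) (RatFunc ℂ) (Polynomial.C C * A) / algebraMap _ _ B, g,
    fun j => ?_, hg, fun z γ hγ => ?_⟩
  · exact mt (hep _).1 (hnonint _ j.2)
  · have hm := hD.isMatched_powerProduct hC γ hγ
    rw [hm.apply_eq hC0 (hAB z), mulRatFuncValue_div hB0]
    · simp
    · exact (hAB z).imp_left fun h => by simpa [hC0] using h
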